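/- \textbf{Conventions.} Let $Z,T$ be topological spaces and let $(g_{m,p})_{(m,p)\in\omega^2}$ be homeomorphisms $g_{m,p}:D_{g_{m,p}}\to \mathrm{Im}(g_{m,p})$ between (possibly empty) subsets $D_{g_{m,p}}\subseteq Z$ and $\mathrm{Im}(g_{m,p})\subseteq T$. The triple $(Z,T,(g_{m,p}))$ is a \emph{general situation} if (a) $Z$ and $T$ are nonempty perfect zero-dimensional Polish spaces; (b) every $D_{g_{m,p}}$ is clopen in $Z$ and every $\mathrm{Im}(g_{m,p})$ is clopen in $T$; (c) for each $m$ the sets $D_{g_{m,p}}$, $p\in\omega$, are pairwise disjoint with union $D_{g_m}$ dense in $Z$; write $g_m:D_{g_m}\to T$ for the function obtained by gluing the $g_{m,p}$, and $\mathrm{Gr}(g_m)$ for its graph; (d) there is a dense $G_\delta$ subset $G(g)$ of $\bigcap_m D_{g_m}$ such that $g[x]:=\{g_m(x): m\in\omega\}$ has no isolated point, for every $x\in G(g)$. It is an \emph{arrival situation} if it is a general situation and, for given compatible metrics on $Z$ and $T$, (1) for some injective $\Delta:\omega^2\to\omega$, the diameters of $D_{g_{m,p}}$ and of $\mathrm{Im}(g_{m,p})$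 are at most $2^{-\Delta(m,p)}$ for all $m,p$; (2) for every $k\ge 1$ and $u\in(\omega^2)^{2k}$, if there is a nonempty clopen $U\subseteq Z$ such that $g_{u(0)}^{-1}g_{u(1)}\cdots g_{u(2k-2)}^{-1}g_{u(2k-1)}(x)$ is defined and equal to $x$ for all $x\in U$, then $u(i)=u(i+1)$ for some $i<2k-1$. A \emph{departure situation} $(F,(f_{n,p})_{(n,p)\in\omega^2})$ is given by $F=\prod_{i\in\omega}A_i\subseteq\omega^\omega$ with each $A_i\subseteq\omega$ finite, such that $(F,F,(f_{n,p}))$ is a general situation and (i) $x<_{\rm lex}f_n(x)$ for all $n$ and $x\in D_{f_n}$, and for all $n,p$ there is $q(n,p)$ such that $f_{n,p}(x)(q)=x(q)$ for all $x\in D_{f_{n,p}}$ and $q>q(n,p)$; (ii) for $(x,y)\in(\bigcap_n D_{f_n}\times F)\cap\overline{\bigcup_n\mathrm{Gr}(f_n)}$ one has $x\neq y$ and there is a sequence $y_k\to y$ with $(x,y_k)\in\bigcup_n\mathrm{Gr}(f_n)$ for all $k$; (iii) for $s,t\in S:=\bigcup_{p}\prod_{i<p}A_i$ write $N_s:=\{x\in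 F: x \text{ extends } s\}$; write $s\,R_n\,t$ if $|s|=|t|$, $s\le_{\rm lex}t$ and $(N_s\times N_t)\cap\mathrm{Gr}(f_n)\ne\emptyset$; write $s\,R\,t$ if $s\,R_n\,t$ for some $n$, and then let $\psi(s,t)$ be the least such $n$. Then $s\,R\,s$ implies $\psi(s,s)=0$, and $s^\frown j\,R\,t^\frown j$ implies $\psi(s^\frown j,t^\frown j)=\psi(s,t)$; (iv) call a nonempty finite sequence of elements of $S$ a chain if any two consecutive terms $a,b$ satisfy $a\,R\,b$ or $b\,R\,a$. If $s,t\in S$ are the first and last terms of some chain, then there is exactly one chain without repetition of terms with first term $s$ and last term $t$. \textbf{Theorem 1.} Let $(F,(f_{n,p})_{(n,p)\in\omega^2})$ be a departure situation and $(Z,T,(g_{m,p})_{(m,p)\in\omega^2})$ an arrival situation, and let $G(g)$ be any set as in (d). Then there are continuous injections $u:F\to G(g)$ and $v:F\to T$ such that (a) for every $(x,y)\in\bigcup_n\mathrm{Gr}(f_n)$, $v(y)\in g[u(x)]$; (b) for every $(x,y)\in\bigl((\bigcap_n D_{f_n}\times F)\cap\overline{\bigcup_n\mathrm{Gr}(f_n)}\bigr)\setminus\bigcup_n\mathrm{Gr}(f_n)$,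 $v(y)\in\overline{g[u(x)]}\setminus g[u(x)]$. -/

import Mathlib

open Set Filter Topology

noncomputable section

section Situations

variable {Z : Type*} {T : Type*} [TopologicalSpace Z] [TopologicalSpace T]

/-- The domain of the glued function `g_m`, i.e. the union over `p` of the domains of `g_{m,p}`. -/
def gluedDomain (g : ℕ → ℕ → OpenPartialHomeomorph Z T) (m : ℕ) : Set Z :=
  ⋃ p, (g m p).source

/-- The intersection over `m` of the domains of the glued functions `g_m`. -/
def commonDomain (g : ℕ → ℕ → OpenPartialHomeomorph Z T) : Set Z :=
  ⋂ m, gluedDomain g m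

/-- The graph of the glued function `g_m`: the pairs `(x, g_{m,p}(x))` for `x` in the
domain of `g_{m,p}`. (The domains are disjoint for distinct `p` in a general situation.) -/
def gluedGraph (g : ℕ → ℕ → OpenPartialHomeomorph Z T) (m : ℕ) : Set (Z × T) :=
  {q | ∃ p, q.1 ∈ (g m p).source ∧ g m p q.1 = q.2}

/-- The union over `m` of the graphs of the glued functions `g_m`. -/
def unionGraph (g : ℕ → ℕ → OpenPartialHomeomorph Z T) : Set (Z × T) :=
  ⋃ m, gluedGraph g m

/-- `g[x]`, the set of the values `g_m(x)`, `m ∈ ℕ`. -/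
def valueSet (g : ℕ → ℕ → OpenPartialHomeomorph Z T) (x : Z) : Set T :=
  {y | ∃ m, (x, y) ∈ gluedGraph g m}

/-- `G` can serve as the set `G(g)` of a general situation: it is a dense `G_δ` subset of the
common domain of the `g_m`, and `g[x]` has no isolated point for `x` in `G`. -/
structure IsResidualDomain (g : ℕ → ℕ → OpenPartialHomeomorph Z T) (G : Set Z) : Prop where
  isGδ : IsGδ G
  subset : G ⊆ commonDomain g
  dense : commonDomain g ⊆ closure G
  no_isolated : ∀ x ∈ G, Preperfect (valueSet g x)

/-- A nonempty perfect zero-dimensional Polish space. -/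
structure IsPerfectZeroDimPolish (X : Type*) [TopologicalSpace X] : Prop where
  polish : PolishSpace X
  perfect : PerfectSpace X
  zeroDim : TopologicalSpace.IsTopologicalBasis {U : Set X | IsClopen U}
  nonempty : Nonempty X

/-- General situations. -/
structure IsGeneralSituation (g : ℕ → ℕ → OpenPartialHomeomorph Z T) : Prop where
  left_space : IsPerfectZeroDimPolish Z
  right_space : IsPerfectZeroDimPolish T
  clopen_source : ∀ m p, IsClopen (g m p).source
  clopen_target : ∀ m p, IsClopen (g m p).target
  disjoint_sources : ∀ m p q, p ≠ q → Disjoint (g m p).source (g m q).source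
  dense_domain : ∀ m, Dense (gluedDomain g m)
  exists_residual : ∃ G : Set Z, IsResidualDomain g G

/-- The partial homeomorphism
`g_{u(0)}⁻¹ g_{u(1)} g_{u(2)}⁻¹ g_{u(3)} ⋯ g_{u(2k-2)}⁻¹ g_{u(2k-1)}` of `Z`, whose source is the
set of the points at which the whole composition is defined.
It depends only on `u(0), …, u(2k-1)`. -/
def alternatingWord (g : ℕ → ℕ → OpenPartialHomeomorph Z T) (u : ℕ → ℕ × ℕ) :
    ℕ → OpenPartialHomeomorph Z Z
  | 0 => OpenPartialHomeomorph.refl Z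
  | k + 1 =>
    ((g (u (2 * k + 1)).1 (u (2 * k + 1)).2).trans
      (g (u (2 * k)).1 (u (2 * k)).2).symm).trans (alternatingWord g u k)

end Situations

/-- Arrival situations. -/
structure IsArrivalSituation {Z : Type*} {T : Type*} [MetricSpace Z] [MetricSpace T]
    (g : ℕ → ℕ → OpenPartialHomeomorph Z T) : Prop where
  general : IsGeneralSituation g
  small_diam : ∃ Δ : ℕ × ℕ → ℕ, Function.Injective Δ ∧ ∀ m p,
    Metric.ediam (g m p).source ≤ (2 : ENNReal)⁻¹ ^ Δ (m, p) ∧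
    Metric.ediam (g m p).target ≤ (2 : ENNReal)⁻¹ ^ Δ (m, p)
  free : ∀ k : ℕ, k ≠ 0 → ∀ u : ℕ → ℕ × ℕ,
    (∃ U : Set Z, IsClopen U ∧ U.Nonempty ∧
      ∀ x ∈ U, x ∈ (alternatingWord g u k).source ∧ alternatingWord g u k x = x) →
    ∃ i, i < 2 * k - 1 ∧ u i = u (i + 1)

section Departure

/-- The product `F = ∏ A_i ⊆ ℕ^ℕ` of a sequence of finite sets of natural numbers, with the
topology induced by the product topology of `ℕ^ℕ`. -/
abbrev SeqProd (A : ℕ → Finset ℕ) : Type := {x : ℕ → ℕ // ∀ i, x i ∈ A i}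

/-- The finite sequence `s` belongs to `⋃_p ∏_{i<p} A_i`. -/
def IsFinSeq (A : ℕ → Finset ℕ) (s : List ℕ) : Prop :=
  ∀ (i : ℕ) (h : i < s.length), s[i] ∈ A i

/-- `N_s`, the set of the elements of `F` that extend the finite sequence `s`. -/
def cylinderSet (A : ℕ → Finset ℕ) (s : List ℕ) : Set (SeqProd A) :=
  {x | ∀ (i : ℕ) (h : i < s.length), x.1 i = s[i]}

variable (A : ℕ → Finset ℕ) (f : ℕ → ℕ → OpenPartialHomeomorph (SeqProd A) (SeqProd A))

/-- The relation `s R_n t` on `⋃_p ∏_{i<p} A_i` (`≤` on `List ℕ` is the lexicographic order). -/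
def RelAt (n : ℕ) (s t : List ℕ) : Prop :=
  IsFinSeq A s ∧ IsFinSeq A t ∧ s.length = t.length ∧ s ≤ t ∧
    ((cylinderSet A s ×ˢ cylinderSet A t) ∩ gluedGraph f n).Nonempty

/-- The relation `s R t`. -/
def GraphRel (s t : List ℕ) : Prop := ∃ n, RelAt A f n s t

/-- `ψ(s,t)`, the least `n` with `s R_n t`; it is used only when `s R t`. -/
def relIndex (s t : List ℕ) : ℕ := sInf {n | RelAt A f n s t}

/-- The symmetric relation `s T t` generated by `R`. -/
def SymRel (s t : List ℕ) : Prop := GraphRel A f s t ∨ GraphRel A f t s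

/-- `c` is a `T`-chain (a nonempty finite sequence of elements of `⋃_p ∏_{i<p} A_i` whose
consecutive terms are `T`-related) with first term `s` and last term `t`. -/
def IsChainFromTo (c : List (List ℕ)) (s t : List ℕ) : Prop :=
  (∀ r ∈ c, IsFinSeq A r) ∧ c.IsChain (SymRel A f) ∧ c.head? = some s ∧ c.getLast? = some t

/-- The equivalence relation `s E t` generated by `R`. -/
def ChainEquiv (s t : List ℕ) : Prop := ∃ c, IsChainFromTo A f c s t

/-- Departure situations. -/
structure IsDepartureSituation : Prop where
  general : IsGeneralSituation f
  lex_lt : ∀ (n : ℕ) (x y : SeqProd A), (x, y) ∈ gluedGraph f n → toLex x.1 < toLex y.1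
  eventually_eq : ∀ n p, ∃ q₀ : ℕ, ∀ q > q₀, ∀ x ∈ (f n p).source, (f n p x).1 q = x.1 q
  closure_graph : ∀ x y : SeqProd A, x ∈ commonDomain f → (x, y) ∈ closure (unionGraph f) →
    (∃ yk : ℕ → SeqProd A, Tendsto yk atTop (𝓝 y) ∧ ∀ k, (x, yk k) ∈ unionGraph f) ∧ x ≠ y
  index_diag : ∀ s, GraphRel A f s s → relIndex A f s s = 0
  index_append : ∀ (s t : List ℕ) (j : ℕ), GraphRel A f (s ++ [j]) (t ++ [j]) →
    relIndex A f (s ++ [j]) (t ++ [j]) = relIndex A f s t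
  unique_chain : ∀ s t, ChainEquiv A f s t →
    ∃! c : List (List ℕ), IsChainFromTo A f c s t ∧ c.Nodup

end Departure

end

/-! ### Baire category: a free orbit with accumulation -/

section GenericOrbit

/-! Both injections are built from the orbit of one generic point of `Z` under the partial maps
`g_{w'}⁻¹ g_w`. By Baire category this orbit can be taken inside `G`, with no point fixed by a
reduced word, and with the `g_m` accumulating at it both forwards and backwards
(`exists_isGenericOrbit`).

For each `l`, every sequence `s` of length `l` receives a point `x s` of the orbit in `Z` and a
point `y s` of the orbit in `T`. These satisfy `g_{w(s,t)} (x s) = y t` along the edges of a tree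
that contains the relation `R`. The tree lives on two copies of the set of sequences, since a
sequence serves both as source and as target. Uniqueness of chains makes `R` a forest on the two
copies (`isAcyclic_bipGraph`), which extends to a tree lying over the tree of the previous length
(`exists_isTree_lift`). The new tree is realized leaf by leaf (`IsRealization.exists_lift`): an edge
whose ends have the same last term inherits the label of the edge below it, and any other edge gets
a new label of large first coordinate. Edges with a common vertex then have distinct labels, so
paths in the tree spell reduced words and freeness keeps the points distinct
(`IsRealization.injective`). Shrinking balls around the points define `u` and `v`.

If `y = f_n(x)`, then `x` and `y` agree from some coordinate on, so the labels along their
restrictions stabilize at some `w`, and `v(y) = g_w(u(x))` in the limit. If `(x, y)` is a limit of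
the graphs outside their union, with `x` in the common domain, then `x` and `y` differ infinitely
often (`IsDepartureSituation.mem_unionGraph_of_eventually_eq`). Each difference at a coordinate `l`
produces an edge with a new label, and there the balls can be chosen to avoid the graphs of all
`g_m`, `m ≤ l`. -/

theorem residual_imp_of_isOpen {X : Type*} [TopologicalSpace X] {O W : Set X}
    (hW : IsOpen W)
    (h : ∀ U : Set X, IsOpen U → U.Nonempty → U ⊆ O → (U ∩ W).Nonempty) (hO : IsOpen O) :
    ∀ᶠ x in residual X, x ∈ O → x ∈ W := by
  have hd : Dense (W ∪ (closure O)ᶜ) := by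
    rw [dense_iff_inter_open]
    intro U hU hne
    by_cases hUO : (U ∩ O).Nonempty
    · obtain ⟨x, ⟨hxU, -⟩, hxW⟩ := h _ (hU.inter hO) hUO inter_subset_right
      exact ⟨x, hxU, Or.inl hxW⟩
    · obtain ⟨x, hx⟩ := hne
      refine ⟨x, hx, Or.inr fun hxO => ?_⟩
      exact hUO (mem_closure_iff.1 hxO U hU hx)
  filter_upwards [residual_of_dense_open (hW.union isClosed_closure.isOpen_compl) hd] with x hx hxO
  exact hx.resolve_right fun h' => h' (subset_closure hxO)

/-- Images of open subsets of the source are open, so they meet every dense open set. Applied to the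
countably many orbit words, this makes a generic property hold along a whole orbit. -/
theorem OpenPartialHomeomorph.residual_preimage {X Y : Type*} [TopologicalSpace X]
    [TopologicalSpace Y] (h : OpenPartialHomeomorph X Y) {C : Set Y} (hC : C ∈ residual Y) :
    ∀ᶠ x in residual X, x ∈ h.source → h x ∈ C := by
  obtain ⟨S, hSo, hSd, hSc, hSC⟩ := mem_residual_iff.1 hC
  have : ∀ t ∈ S, ∀ᶠ x in residual X, x ∈ h.source → x ∈ h.source ∩ h ⁻¹' t := by
    intro t ht
    refine residual_imp_of_isOpen (h.isOpen_inter_preimage (hSo t ht)) ?_ h.open_source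
    intro U hU hne hUs
    obtain ⟨y, ⟨x, hx, rfl⟩, hy⟩ := (hSd t ht).inter_open_nonempty _
      (h.isOpen_image_of_subset_source hU hUs) (hne.image h)
    exact ⟨x, hx, hUs hx, hy⟩
  filter_upwards [(eventually_countable_ball hSc).2 this] with x hx hxs
  exact hSC fun t ht => (hx t ht hxs).2

variable {Z : Type*} {T : Type*} [TopologicalSpace Z] [TopologicalSpace T]

/-- `OZ` and `OT` are the traces on `Z` and `T` of a union of orbits under the `g_{m,p}`, made of
points of `G` that are not fixed by any reduced word and at which the `g_{m,p}` accumulate. -/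
structure IsGenericOrbit (g : ℕ → ℕ → OpenPartialHomeomorph Z T) (G : Set Z)
    (OZ : Set Z) (OT : Set T) : Prop where
  subset : OZ ⊆ G
  map : ∀ z ∈ OZ, ∀ w : ℕ × ℕ, z ∈ (g w.1 w.2).source → g w.1 w.2 z ∈ OT
  map_symm : ∀ y ∈ OT, ∀ w : ℕ × ℕ, y ∈ (g w.1 w.2).target → (g w.1 w.2).symm y ∈ OZ
  accumulate : ∀ z ∈ OZ, ∀ w₀ : ℕ × ℕ, z ∈ (g w₀.1 w₀.2).source → ∀ V : Set T, IsOpen V →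
    g w₀.1 w₀.2 z ∈ V → ∀ M : ℕ, ∃ w : ℕ × ℕ, M < w.1 ∧ z ∈ (g w.1 w.2).source ∧ g w.1 w.2 z ∈ V
  accumulate_symm : ∀ z ∈ OZ, ∀ w₀ : ℕ × ℕ, z ∈ (g w₀.1 w₀.2).source → ∀ U : Set Z, IsOpen U →
    z ∈ U → ∀ M : ℕ, ∃ w : ℕ × ℕ, M < w.1 ∧ ∃ z' ∈ U, z' ∈ (g w.1 w.2).source ∧
      g w.1 w.2 z' = g w₀.1 w₀.2 z
  free : ∀ z ∈ OZ, ∀ k, k ≠ 0 → ∀ u : ℕ → ℕ × ℕ, (∀ i, i < 2 * k - 1 → u i ≠ u (i + 1)) →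
    z ∈ (alternatingWord g u k).source → alternatingWord g u k z ≠ z

/-- The composition of the partial homeomorphisms `g_{w'}⁻¹ g_w`, for the pairs `(w, w')` of a
list. -/
def orbitWord (g : ℕ → ℕ → OpenPartialHomeomorph Z T) :
    List ((ℕ × ℕ) × (ℕ × ℕ)) → OpenPartialHomeomorph Z Z
  | [] => OpenPartialHomeomorph.refl Z
  | p :: L => (orbitWord g L).trans ((g p.1.1 p.1.2).trans (g p.2.1 p.2.2).symm)

theorem alternatingWord_congr (g : ℕ → ℕ → OpenPartialHomeomorph Z T) {u u' : ℕ → ℕ × ℕ} {k : ℕ}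
    (h : ∀ i < 2 * k, u i = u' i) : alternatingWord g u k = alternatingWord g u' k := by
  induction k with
  | zero => rfl
  | succ k ih =>
    simp only [alternatingWord]
    rw [ih fun i hi => h i (by omega), h (2 * k) (by omega), h (2 * k + 1) (by omega)]

theorem IsResidualDomain.mem_residual {g : ℕ → ℕ → OpenPartialHomeomorph Z T} {G : Set Z}
    [BaireSpace Z] (hG : IsResidualDomain g G) (hd : ∀ m, Dense (gluedDomain g m)) :
    G ∈ residual Z := by
  have h1 : Dense (commonDomain g) :=
    dense_iInter_of_isOpen_nat (fun m => isOpen_iUnion fun p => (g m p).open_source) hd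
  refine residual_of_dense_Gδ hG.isGδ fun x => ?_
  have := closure_mono hG.dense (h1 x)
  rwa [closure_closure] at this

/-- The maps `g_m` with `m ≤ M` take finitely many values at `z`. Removing those other than
`g_{w₀}(z)` leaves a neighborhood of this point, which is not isolated in `g[z]`. -/
theorem IsResidualDomain.exists_large_index {g : ℕ → ℕ → OpenPartialHomeomorph Z T} {G : Set Z}
    [T1Space T] (hdis : ∀ m p q, p ≠ q → Disjoint (g m p).source (g m q).source)
    (hG : IsResidualDomain g G) {z : Z} (hz : z ∈ G) {w₀ : ℕ × ℕ}
    (h₀ : z ∈ (g w₀.1 w₀.2).source) {V : Set T} (hV : IsOpen V) (hzV : g w₀.1 w₀.2 z ∈ V) (M : ℕ) :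
    ∃ w : ℕ × ℕ, M < w.1 ∧ z ∈ (g w.1 w.2).source ∧ g w.1 w.2 z ∈ V := by
  have hu : ∀ m, {y | (z, y) ∈ gluedGraph g m}.Subsingleton := by
    rintro m y ⟨p, hp, hy⟩ y' ⟨q, hq, hy'⟩
    by_cases hpq : p = q
    · subst hpq; exact hy.symm.trans hy'
    · exact absurd hq ((hdis m p q hpq).notMem_of_mem_left hp)
  have hfin : (⋃ m ∈ Iic M, {y | (z, y) ∈ gluedGraph g m} \ {g w₀.1 w₀.2 z}).Finite :=
    (finite_Iic M).biUnion fun m _ => (hu m).finite.subset sdiff_subset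
  obtain ⟨y, ⟨⟨hyV, hyF⟩, m, p, hp, hy⟩, hne⟩ := preperfect_iff_nhds.1 (hG.no_isolated z hz)
    (g w₀.1 w₀.2 z) ⟨w₀.1, w₀.2, h₀, rfl⟩ _
    ((hV.inter hfin.isClosed.isOpen_compl).mem_nhds ⟨hzV, by simp⟩)
  refine ⟨(m, p), ?_, hp, (show g m p z = y from hy) ▸ hyV⟩
  by_contra hm
  refine hyF (mem_biUnion (show m ∈ Iic M from not_lt.1 hm) ⟨⟨p, hp, hy⟩, hne⟩)

/-- Non-isolation only gives accumulation in `T`; it is transferred to `Z` by exchanging two points.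
If `z ∈ O ∩ G` and `g_w(z)` falls in `g_{w₀}(O)`, say `g_w(z) = g_{w₀}(z')`, then `z'` is a point of
`O` whose image is also reached from `z` by `g_w`. Hence the required open condition is dense. -/
theorem residual_accumulate_symm {g : ℕ → ℕ → OpenPartialHomeomorph Z T} {G : Set Z}
    [T1Space T] [BaireSpace Z] [SecondCountableTopology Z]
    (hdis : ∀ m p q, p ≠ q → Disjoint (g m p).source (g m q).source)
    (hG : IsResidualDomain g G) (hd : ∀ m, Dense (gluedDomain g m)) :
    ∀ᶠ z in residual Z, ∀ w₀ : ℕ × ℕ, z ∈ (g w₀.1 w₀.2).source → ∀ U : Set Z, IsOpen U →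
      z ∈ U → ∀ M : ℕ, ∃ w : ℕ × ℕ, M < w.1 ∧ ∃ z' ∈ U, z' ∈ (g w.1 w.2).source ∧
      g w.1 w.2 z' = g w₀.1 w₀.2 z := by
  let B := TopologicalSpace.countableBasis Z
  have key : ∀ w₀ : ℕ × ℕ, ∀ U ∈ B, ∀ M : ℕ, ∀ᶠ z in residual Z,
      z ∈ (g w₀.1 w₀.2).source ∩ U → z ∈ (g w₀.1 w₀.2).source ∩ g w₀.1 w₀.2 ⁻¹'
        (⋃ w ∈ {w : ℕ × ℕ | M < w.1}, g w.1 w.2 '' ((g w.1 w.2).source ∩ U)) := by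
    intro w₀ U hU M
    have hUo : IsOpen U := TopologicalSpace.isOpen_of_mem_countableBasis hU
    refine residual_imp_of_isOpen ?_ ?_ ((g w₀.1 w₀.2).open_source.inter hUo)
    · refine (g w₀.1 w₀.2).isOpen_inter_preimage (isOpen_biUnion fun w _ => ?_)
      exact (g w.1 w.2).isOpen_image_of_subset_source ((g w.1 w.2).open_source.inter hUo)
        inter_subset_left
    · intro O hO hne hOs
      obtain ⟨z, hzO, hzG⟩ :=
        (dense_of_mem_residual (hG.mem_residual hd)).inter_open_nonempty O hO hne
      have hOs' : O ⊆ (g w₀.1 w₀.2).source := hOs.trans inter_subset_left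
      obtain ⟨w, hMw, hzw, z', hz', hzz'⟩ := hG.exists_large_index hdis hzG (hOs hzO).1
        ((g w₀.1 w₀.2).isOpen_image_of_subset_source hO hOs') (mem_image_of_mem _ hzO) M
      refine ⟨z', hz', hOs' hz', ?_⟩
      exact mem_biUnion (show w ∈ {w : ℕ × ℕ | M < w.1} from hMw)
        ⟨z, ⟨hzw, (hOs hzO).2⟩, hzz'.symm⟩
  have := eventually_countable_forall.2 fun w₀ : ℕ × ℕ =>
    (eventually_countable_ball (TopologicalSpace.countable_countableBasis Z)).2 fun U hU =>
      eventually_countable_forall.2 fun M => key w₀ U hU M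
  filter_upwards [this] with z hz w₀ hw₀ U hU hzU M
  obtain ⟨V, hVB, hzV, hVU⟩ :=
    (TopologicalSpace.isBasis_countableBasis Z).exists_subset_of_mem_open hzU hU
  obtain ⟨-, hz2⟩ := hz w₀ V hVB M ⟨hw₀, hzV⟩
  obtain ⟨w, hw, z', hz', he⟩ := mem_iUnion₂.1 hz2
  exact ⟨w, hw, z', hVU hz'.2, hz'.1, he⟩

theorem residual_free [T2Space Z] {g : ℕ → ℕ → OpenPartialHomeomorph Z T}
    (hzd : TopologicalSpace.IsTopologicalBasis {U : Set Z | IsClopen U})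
    (free : ∀ k : ℕ, k ≠ 0 → ∀ u : ℕ → ℕ × ℕ,
      (∃ U : Set Z, IsClopen U ∧ U.Nonempty ∧
        ∀ x ∈ U, x ∈ (alternatingWord g u k).source ∧ alternatingWord g u k x = x) →
      ∃ i, i < 2 * k - 1 ∧ u i = u (i + 1)) :
    ∀ᶠ z in residual Z, ∀ k, k ≠ 0 → ∀ u : ℕ → ℕ × ℕ, (∀ i, i < 2 * k - 1 → u i ≠ u (i + 1)) →
      z ∈ (alternatingWord g u k).source → alternatingWord g u k z ≠ z := by
  -- A word depends on finitely many letters, so lists, which are countably many, replace the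
  -- sequences `u`. The default value of `getD` is never read when the list has length `2 * k`.
  have key : ∀ k, ∀ L : List (ℕ × ℕ), ∀ᶠ z in residual Z, k ≠ 0 →
      (∀ i, i < 2 * k - 1 → L.getD i 0 ≠ L.getD (i + 1) 0) →
      z ∈ (alternatingWord g (fun i => L.getD i 0) k).source →
      alternatingWord g (fun i => L.getD i 0) k z ≠ z := by
    intro k L
    by_cases hk : k = 0
    · exact Eventually.of_forall fun z h => absurd hk h
    by_cases hL : ∀ i, i < 2 * k - 1 → L.getD i 0 ≠ L.getD (i + 1) 0
    swap
    · exact Eventually.of_forall fun z _ h => absurd h hL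
    set h := alternatingWord g (fun i => L.getD i 0) k with hh
    have hW : IsOpen (h.source ∩ (fun z => (h z, z)) ⁻¹' (diagonal Z)ᶜ) :=
      (h.continuousOn.prodMk continuousOn_id).isOpen_inter_preimage h.open_source
        isClosed_diagonal.isOpen_compl
    have := residual_imp_of_isOpen (O := h.source) hW ?_ h.open_source
    · filter_upwards [this] with z hz _ _ hzs
      exact (hz hzs).2
    · intro O hO ⟨z, hz⟩ hOs
      by_contra hcon
      obtain ⟨U, hU, hzU, hUO⟩ := hzd.exists_subset_of_mem_open hz hO
      obtain ⟨i, hi, he⟩ := free k hk (fun i => L.getD i 0) ⟨U, hU, ⟨z, hzU⟩, fun x hx =>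
        ⟨hOs (hUO hx), by_contra fun hne => hcon ⟨x, hUO hx, hOs (hUO hx), hne⟩⟩⟩
      exact hL i hi he
  filter_upwards [eventually_countable_forall.2 fun k => eventually_countable_forall.2 (key k)]
    with z hz k hk u hu
  have hL : ∀ i < 2 * k, u i = ((List.range (2 * k)).map u).getD i 0 := by
    intro i hi
    simp [List.getD, hi]
  rw [alternatingWord_congr g hL]
  refine hz k _ hk fun i hi => ?_
  rw [← hL i (by omega), ← hL (i + 1) (by omega)]
  exact hu i hi

theorem exists_isGenericOrbit [PolishSpace Z] [T1Space T] [Nonempty Z]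
    {g : ℕ → ℕ → OpenPartialHomeomorph Z T}
    (hzd : TopologicalSpace.IsTopologicalBasis {U : Set Z | IsClopen U})
    (hdis : ∀ m p q, p ≠ q → Disjoint (g m p).source (g m q).source)
    (hd : ∀ m, Dense (gluedDomain g m))
    (free : ∀ k : ℕ, k ≠ 0 → ∀ u : ℕ → ℕ × ℕ,
      (∃ U : Set Z, IsClopen U ∧ U.Nonempty ∧
        ∀ x ∈ U, x ∈ (alternatingWord g u k).source ∧ alternatingWord g u k x = x) →
      ∃ i, i < 2 * k - 1 ∧ u i = u (i + 1))
    {G : Set Z} (hG : IsResidualDomain g G) :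
    ∃ OZ OT, IsGenericOrbit g G OZ OT ∧ OZ.Nonempty := by
  have hres := (eventually_mem_set.2 (hG.mem_residual hd)).and
    ((residual_accumulate_symm hdis hG hd).and (residual_free hzd free))
  obtain ⟨z₀, hz₀⟩ := (dense_of_mem_residual (eventually_countable_forall.2 fun L =>
    (orbitWord g L).residual_preimage hres)).nonempty
  refine ⟨{z | ∃ L, z₀ ∈ (orbitWord g L).source ∧ orbitWord g L z₀ = z},
    {y | ∃ L, z₀ ∈ (orbitWord g L).source ∧ ∃ w : ℕ × ℕ,
      orbitWord g L z₀ ∈ (g w.1 w.2).source ∧ g w.1 w.2 (orbitWord g L z₀) = y}, ⟨?_, ?_, ?_, ?_,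
      ?_, ?_⟩, z₀, [], trivial, rfl⟩
  · rintro _ ⟨L, hL, rfl⟩
    exact (hz₀ L hL).1
  · rintro _ ⟨L, hL, rfl⟩ w hw
    exact ⟨L, hL, w, hw, rfl⟩
  · rintro _ ⟨L, hL, w, hw, rfl⟩ w' hw'
    exact ⟨(w, w') :: L, by simp [orbitWord, hL, hw, hw'], rfl⟩
  · rintro _ ⟨L, hL, rfl⟩ w₀ hw₀ V hV hzV M
    exact hG.exists_large_index hdis (hz₀ L hL).1 hw₀ hV hzV M
  · rintro _ ⟨L, hL, rfl⟩
    exact (hz₀ L hL).2.1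
  · rintro _ ⟨L, hL, rfl⟩
    exact (hz₀ L hL).2.2

/-- A zigzag `x_0, x_1, …, x_k` in which neighbors have a common image in `T` spells a word that
runs back from `x_k` to `x_0`. -/
theorem alternatingWord_apply_of_chain {g : ℕ → ℕ → OpenPartialHomeomorph Z T} {xs : ℕ → Z}
    {u : ℕ → ℕ × ℕ} {k : ℕ}
    (h : ∀ i < k, xs i ∈ (g (u (2 * i)).1 (u (2 * i)).2).source ∧
      xs (i + 1) ∈ (g (u (2 * i + 1)).1 (u (2 * i + 1)).2).source ∧
      g (u (2 * i + 1)).1 (u (2 * i + 1)).2 (xs (i + 1)) = g (u (2 * i)).1 (u (2 * i)).2 (xs i)) :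
    xs k ∈ (alternatingWord g u k).source ∧ alternatingWord g u k (xs k) = xs 0 := by
  induction k with
  | zero => exact ⟨trivial, rfl⟩
  | succ k ih =>
    obtain ⟨h1, h2⟩ := ih fun i hi => h i (by omega)
    obtain ⟨h3, h4, h5⟩ := h k (by omega)
    have h6 := (g (u (2 * k)).1 (u (2 * k)).2).map_source h3
    have h7 := (g (u (2 * k)).1 (u (2 * k)).2).left_inv h3
    simp only [alternatingWord, OpenPartialHomeomorph.trans_source, mem_inter_iff, mem_preimage,
      OpenPartialHomeomorph.coe_trans, Function.comp_apply, OpenPartialHomeomorph.symm_source]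
    rw [h5, h7]
    exact ⟨⟨⟨h4, h6⟩, h1⟩, h2⟩

theorem IsGenericOrbit.ne_of_chain {g : ℕ → ℕ → OpenPartialHomeomorph Z T} {G : Set Z} {OZ : Set Z}
    {OT : Set T} (hO : IsGenericOrbit g G OZ OT) {xs : ℕ → Z}
    {u : ℕ → ℕ × ℕ} {k : ℕ} (hk : k ≠ 0) (hxs : xs k ∈ OZ)
    (h : ∀ i < k, xs i ∈ (g (u (2 * i)).1 (u (2 * i)).2).source ∧
      xs (i + 1) ∈ (g (u (2 * i + 1)).1 (u (2 * i + 1)).2).source ∧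
      g (u (2 * i + 1)).1 (u (2 * i + 1)).2 (xs (i + 1)) = g (u (2 * i)).1 (u (2 * i)).2 (xs i))
    (hu : ∀ i, i < 2 * k - 1 → u i ≠ u (i + 1)) : xs k ≠ xs 0 := by
  obtain ⟨h1, h2⟩ := alternatingWord_apply_of_chain h
  intro he
  exact hO.free _ hxs k hk u hu h1 (h2.trans he.symm)

end GenericOrbit

/-! ### Bipartite doubling, forests and spanning trees -/

section BipartiteTrees

variable {P Q V : Type*}

/-- The bipartite graph on two copies of `P` that has an edge from `s` in the first copy to `t` in
the second copy when `E s t`. -/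
def bipGraph (E : P → P → Prop) : SimpleGraph (P ⊕ P) where
  Adj a b := match a, b with
    | Sum.inl s, Sum.inr t => E s t
    | Sum.inr t, Sum.inl s => E s t
    | _, _ => False
  symm := ⟨by rintro (a | a) (b | b) h <;> exact h⟩
  loopless := ⟨by rintro (a | a) h <;> exact h⟩

@[simp] theorem bipGraph_inl_inr (E : P → P → Prop) (s t : P) :
    (bipGraph E).Adj (Sum.inl s) (Sum.inr t) ↔ E s t := Iff.rfl

@[simp] theorem bipGraph_inr_inl (E : P → P → Prop) (s t : P) :
    (bipGraph E).Adj (Sum.inr t) (Sum.inl s) ↔ E s t := Iff.rfl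

@[simp] theorem bipGraph_inl_inl (E : P → P → Prop) (s t : P) :
    ¬ (bipGraph E).Adj (Sum.inl s) (Sum.inl t) := id

@[simp] theorem bipGraph_inr_inr (E : P → P → Prop) (s t : P) :
    ¬ (bipGraph E).Adj (Sum.inr s) (Sum.inr t) := id

theorem SimpleGraph.not_reachable_of_cut {Γ : SimpleGraph V} {X : Set V}
    (h : ∀ a b, Γ.Adj a b → a ∈ X → b ∈ X) {u v : V} (hu : u ∈ X) (hv : v ∉ X) :
    ¬ Γ.Reachable u v := by
  rintro ⟨p⟩
  obtain ⟨d, -, h1, h2⟩ := p.exists_boundary_dart X hu hv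
  exact h2 (h _ _ d.adj h1)

/-- A finite tree grows from a vertex by adding leaves. Take a maximal `S` that satisfies `p` and is
connected inside itself. An edge leaving `S` ends at a vertex with only one neighbor in `S`, as a
second one would give two paths between the same ends, one through this vertex and one inside `S`.
-/
theorem SimpleGraph.IsTree.grow_induction [Finite V] {Γ : SimpleGraph V} (hΓ : Γ.IsTree)
    {p : Set V → Prop} (base : ∀ r, p {r})
    (step : ∀ S v b, p S → b ∈ S → v ∉ S → Γ.Adj v b → (∀ c ∈ S, Γ.Adj v c → c = b) →
      p (insert v S)) : p univ := by
  obtain ⟨r⟩ := hΓ.connected.nonempty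
  let good : Set V → Prop := fun S => p S ∧ S.Nonempty ∧
    ∀ a ∈ S, ∀ b ∈ S, ∃ q : Γ.Walk a b, ∀ c ∈ q.support, c ∈ S
  have hr : good {r} := by
    refine ⟨base r, ⟨r, rfl⟩, ?_⟩
    rintro a rfl b rfl
    exact ⟨SimpleGraph.Walk.nil, by simp⟩
  obtain ⟨S, ⟨hpS, ⟨a₀, ha₀⟩, hS⟩, hmax⟩ := (Set.toFinite {S | good S}).exists_maximal ⟨_, hr⟩
  by_cases hun : S = univ
  · exact hun ▸ hpS
  exfalso
  obtain ⟨v₀, hv₀⟩ := (ne_univ_iff_exists_notMem S).1 hun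
  obtain ⟨q⟩ := hΓ.connected.preconnected a₀ v₀
  obtain ⟨d, -, hb, hv⟩ := q.exists_boundary_dart S ha₀ hv₀
  have huniq : ∀ c ∈ S, Γ.Adj d.snd c → c = d.fst := by
    intro c hc hadj
    by_contra hne
    obtain ⟨q, hq⟩ := hS d.fst hb c hc
    classical
    have hpath : (SimpleGraph.Walk.cons d.adj (SimpleGraph.Walk.cons hadj
        SimpleGraph.Walk.nil)).IsPath := by
      have h1 := d.adj.ne
      have h2 := hadj.ne
      simp [h1, h2, Ne.symm hne]
    have := (hΓ.isAcyclic.subsingleton_path _ _).elim q.toPath ⟨_, hpath⟩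
    have hmem : d.snd ∈ (q.toPath : Γ.Walk d.fst c).support := by
      rw [this]; simp
    exact hv (hq _ (q.support_toPath_subset_support hmem))
  have hgood : good (insert d.snd S) := by
    refine ⟨step S d.snd d.fst hpS hb hv d.adj.symm huniq, ⟨a₀, Or.inr ha₀⟩, ?_⟩
    have hto : ∀ a ∈ insert d.snd S, ∃ q : Γ.Walk a d.fst, ∀ c ∈ q.support, c ∈ insert d.snd S := by
      rintro a (rfl | ha)
      · exact ⟨d.adj.symm.toWalk, by simp [hb]⟩
      · obtain ⟨q, hq⟩ := hS a ha _ hb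
        exact ⟨q, fun c hc => Or.inr (hq c hc)⟩
    intro a ha b hb'
    obtain ⟨q, hq⟩ := hto a ha
    obtain ⟨q', hq'⟩ := hto b hb'
    refine ⟨q.append q'.reverse, fun c hc => ?_⟩
    rcases (SimpleGraph.Walk.mem_support_append_iff _ _).1 hc with h | h
    · exact hq c h
    · exact hq' c (by simpa using h)
  exact hv (hmax hgood (subset_insert _ _) (mem_insert _ _))

/-- Doubling the vertices of an oriented forest, possibly with loops, gives a forest. -/
theorem isAcyclic_bipGraph {R : P → P → Prop} (hanti : ∀ s t, R s t → R t s → s = t)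
    (hac : (SimpleGraph.fromRel R).IsAcyclic) : (bipGraph R).IsAcyclic := by
  rw [SimpleGraph.isAcyclic_iff_forall_adj_isBridge] at hac ⊢
  have key : ∀ s t, R s t → ¬ ((bipGraph R).deleteEdges {s(Sum.inl s, Sum.inr t)}).Reachable
      (Sum.inl s) (Sum.inr t) := by
    intro s t hst
    by_cases hne : s = t
    · subst hne
      -- A loop at `s` becomes the edge joining the two copies of `s`. To cut it, remove all edges
      -- directed out of `s`: coming back to `Sum.inl s` by another edge would join `s` to some
      -- out-neighbor without them, against acyclicity.
      set C := (SimpleGraph.fromRel R).deleteEdges {e | ∃ t, R s t ∧ e = s(s, t)} with hC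
      have hedge : ∀ p q, R p q → p ≠ s → C.Reachable p q := by
        intro p q hpq hp
        by_cases hpq' : p = q
        · subst hpq'; rfl
        refine SimpleGraph.Adj.reachable ?_
        rw [hC, SimpleGraph.deleteEdges_adj, SimpleGraph.fromRel_adj]
        refine ⟨⟨hpq', Or.inl hpq⟩, ?_⟩
        rintro ⟨t, hst', he⟩
        rcases Sym2.eq_iff.1 he with ⟨rfl, rfl⟩ | ⟨rfl, rfl⟩
        · exact hp rfl
        · exact hpq' (hanti _ _ hpq hst')
      have hbr : ∀ t, R s t → t ≠ s → ¬ C.Reachable s t := by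
        intro t hst' hts hr
        have := hac (v := s) (w := t) (by simp [hts.symm, hst'])
        rw [SimpleGraph.isBridge_iff] at this
        refine this (hr.mono ?_)
        refine SimpleGraph.deleteEdges_anti ?_
        rintro _ rfl
        exact ⟨t, hst', rfl⟩
      rw [SimpleGraph.reachable_comm]
      refine SimpleGraph.not_reachable_of_cut
        (X := {v | v ≠ Sum.inl s ∧ C.Reachable s (v.elim id id)}) ?_ ⟨by simp, by simp⟩ (by simp)
      rintro (p | p) (q | q) hadj ⟨h1, h2⟩ <;>
        simp only [SimpleGraph.deleteEdges_adj, bipGraph_inl_inl, bipGraph_inl_inr,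
          bipGraph_inr_inl, bipGraph_inr_inr, false_and] at hadj
      · exact ⟨by simp, h2.trans (hedge p q hadj.1 (by simpa using h1))⟩
      · have hq : q ≠ s := by
          rintro rfl
          refine hbr p hadj.1 ?_ h2
          rintro rfl
          exact hadj.2 (by simp [Sym2.eq_swap])
        exact ⟨by simpa using hq, h2.trans (hedge q p hadj.1 hq).symm⟩
    -- The projection of the doubled graph sends every other edge to a loop or to an edge other than
    -- `{s, t}`; antisymmetry excludes `R t s`.
    · set C := (SimpleGraph.fromRel R).deleteEdges {s(s, t)} with hC
      have hedge : ∀ p q, R p q → ¬ (p = s ∧ q = t) → C.Reachable p q := by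
        intro p q hpq hp
        by_cases hpq' : p = q
        · subst hpq'; rfl
        refine SimpleGraph.Adj.reachable ?_
        rw [hC, SimpleGraph.deleteEdges_adj, SimpleGraph.fromRel_adj]
        refine ⟨⟨hpq', Or.inl hpq⟩, fun he => ?_⟩
        rcases Sym2.eq_iff.1 he with ⟨rfl, rfl⟩ | ⟨rfl, rfl⟩
        · exact hp ⟨rfl, rfl⟩
        · exact hne (hanti _ _ hst hpq)
      have hbr : ¬ C.Reachable s t := SimpleGraph.isBridge_iff.1 (hac (by simp [hne, hst]))
      refine SimpleGraph.not_reachable_of_cut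
        (X := {v | C.Reachable s (v.elim id id)}) ?_ (by simp) (by simpa using hbr)
      rintro (p | p) (q | q) hadj h2 <;>
        simp only [SimpleGraph.deleteEdges_adj, bipGraph_inl_inl, bipGraph_inl_inr,
          bipGraph_inr_inl, bipGraph_inr_inr, false_and] at hadj
      · exact SimpleGraph.Reachable.trans h2 (hedge p q hadj.1 (by simpa using hadj.2))
      · refine SimpleGraph.Reachable.trans h2 (hedge q p hadj.1 ?_).symm
        rintro ⟨rfl, rfl⟩
        exact hadj.2 (by simp [Sym2.eq_swap])
  rintro (s | s) (t | t) hadj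
  · exact absurd hadj (by simp)
  · exact SimpleGraph.isBridge_iff.2 (key s t hadj)
  · rw [Sym2.eq_swap, SimpleGraph.isBridge_iff]
    exact key t s hadj
  · exact absurd hadj (by simp)

/-- Walks lift edge by edge, with free choice in each fibre. Two points of one fibre are joined
through a lift of a neighbor of their common image. -/
theorem connected_bipGraph_comap {E : P → P → Prop} (hE : (bipGraph E).Connected) {π : Q → P}
    (hπ : Function.Surjective π) : (bipGraph fun q r => E (π q) (π r)).Connected := by
  set H := bipGraph fun q r => E (π q) (π r)
  have hadj : ∀ a b : Q ⊕ Q, (bipGraph E).Adj (a.map π π) (b.map π π) → H.Adj a b := by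
    rintro (a | a) (b | b) h <;> exact h
  have hsurj : ∀ c : P ⊕ P, ∃ a : Q ⊕ Q, a.map π π = c := Sum.map_surjective.2 ⟨hπ, hπ⟩
  have hnbr : ∀ c : P ⊕ P, ∃ d, (bipGraph E).Adj c d := by
    have hnt : Nontrivial (P ⊕ P) := by
      obtain ⟨c⟩ := hE.nonempty
      exact ⟨Sum.inl (c.elim id id), Sum.inr (c.elim id id), by simp⟩
    intro c
    exact hE.preconnected.exists_adj_of_nontrivial c
  have key : ∀ c d : P ⊕ P, (bipGraph E).Walk c d → ∀ a b : Q ⊕ Q, a.map π π = c →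
      b.map π π = d → H.Reachable a b := by
    intro c d p
    induction p with
    | nil =>
      intro a b ha hb
      obtain ⟨d, hd⟩ := hnbr (a.map π π)
      obtain ⟨e, rfl⟩ := hsurj d
      refine (hadj a e hd).reachable.trans (hadj b e ?_).reachable.symm
      rwa [hb, ← ha]
    | @cons _ m _ h p ih =>
      rintro a b rfl hb
      obtain ⟨e, rfl⟩ := hsurj m
      exact (hadj a e h).reachable.trans (ih e b rfl hb)
  obtain ⟨c⟩ := hE.nonempty
  refine { preconnected := fun a b => ?_, nonempty := ?_ }
  · obtain ⟨p⟩ := hE.preconnected (a.map π π) (b.map π π)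
    exact key _ _ p a b rfl rfl
  · obtain ⟨a, -⟩ := hsurj c
    exact ⟨a⟩

/-- The pullback of `E` is connected and contains the forest given by `R`, which therefore extends
to a spanning tree of it. -/
theorem exists_isTree_lift {E : P → P → Prop} (hE : (bipGraph E).Connected) {π : Q → P}
    (hπ : Function.Surjective π) {R : Q → Q → Prop} (hR : (bipGraph R).IsAcyclic)
    (hRE : ∀ q r, R q r → E (π q) (π r)) :
    ∃ E' : Q → Q → Prop, (bipGraph E').IsTree ∧ (∀ q r, R q r → E' q r) ∧
      ∀ q r, E' q r → E (π q) (π r) := by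
  obtain ⟨F, hRF, hFH, hF⟩ := (connected_bipGraph_comap hE hπ).exists_isTree_le_of_le_of_isAcyclic
    (H := bipGraph R) (by rintro (a | a) (b | b) h <;> first | exact hRE _ _ h | exact h) hR
  have hFE : bipGraph (fun q r => F.Adj (Sum.inl q) (Sum.inr r)) = F := by
    ext a b
    rcases a with a | a <;> rcases b with b | b
    · exact ⟨fun h => h.elim, fun h => hFH h⟩
    · rfl
    · exact F.adj_comm _ _
    · exact ⟨fun h => h.elim, fun h => hFH h⟩
  exact ⟨fun q r => F.Adj (Sum.inl q) (Sum.inr r), hFE ▸ hF, fun q r h => hRF h,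
    fun q r h => hFH h⟩

end BipartiteTrees

/-! ### Realizations of trees inside an orbit, and their injectivity -/

section Realizations

variable {Z : Type*} {T : Type*} [TopologicalSpace Z] [TopologicalSpace T] {P Q : Type*}

/-- The points `x s`, `y t` of `OZ` and `OT` are linked by the maps `g_{w(s,t)}` along the edges of
`E`. -/
structure IsRealization (g : ℕ → ℕ → OpenPartialHomeomorph Z T) (OZ : Set Z) (OT : Set T)
    (E : P → P → Prop) (x : P → Z) (y : P → T) (w : P → P → ℕ × ℕ) : Prop where
  mem_left : ∀ s, x s ∈ OZ
  mem_right : ∀ t, y t ∈ OT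
  mem_source : ∀ s t, E s t → x s ∈ (g (w s t).1 (w s t).2).source
  apply_eq : ∀ s t, E s t → g (w s t).1 (w s t).2 (x s) = y t

/-- Two distinct edges of `E` with a common vertex have distinct labels. -/
structure IsProperLabel (E : P → P → Prop) (w : P → P → ℕ × ℕ) : Prop where
  right : ∀ s t t', E s t → E s t' → w s t = w s t' → t = t'
  left : ∀ s s' t, E s t → E s' t → w s t = w s' t → s = s'

/-- The label of an edge of the bipartite graph. -/
def edgeLabel (w : P → P → ℕ × ℕ) : P ⊕ P → P ⊕ P → ℕ × ℕ
  | Sum.inl s, Sum.inr t => w s t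
  | Sum.inr t, Sum.inl s => w s t
  | _, _ => 0

theorem IsProperLabel.edgeLabel_ne {E : P → P → Prop} {w : P → P → ℕ × ℕ} (hw : IsProperLabel E w)
    {a b c : P ⊕ P} (hab : (bipGraph E).Adj a b) (hbc : (bipGraph E).Adj b c) (hac : a ≠ c) :
    edgeLabel w a b ≠ edgeLabel w b c := by
  intro h
  rcases a with s | s <;> rcases b with t | t <;> rcases c with r | r <;>
    simp only [bipGraph_inl_inl, bipGraph_inl_inr, bipGraph_inr_inl, bipGraph_inr_inr]
      at hab hbc
  · exact hac (congrArg _ (hw.left _ _ _ hab hbc h))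
  · exact hac (congrArg _ (hw.right _ _ _ hab hbc h))

theorem bipGraph_isLeft_iff {E : P → P → Prop} {v : ℕ → P ⊕ P} {n : ℕ}
    (hv : ∀ i < n, (bipGraph E).Adj (v i) (v (i + 1))) {i : ℕ} (hi : i ≤ n) :
    (v i).isLeft ↔ ((v 0).isLeft ↔ Even i) := by
  induction i with
  | zero => simp
  | succ i ih =>
    have h1 := ih (by omega)
    have h2 : (v (i + 1)).isLeft ↔ ¬ (v i).isLeft := by
      have := hv i (by omega)
      rcases hvi : v i with s | s <;> rcases hvi' : v (i + 1) with t | t <;> simp_all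
    rw [h2, h1, Nat.even_add_one]
    tauto

variable {g : ℕ → ℕ → OpenPartialHomeomorph Z T} {G : Set Z} {OZ : Set Z} {OT : Set T}
  {E : P → P → Prop} {x : P → Z} {y : P → T} {w : P → P → ℕ × ℕ}

/-- A path without backtracking reads a reduced word sending `x b` to `x a`, so freeness applies. -/
theorem IsRealization.ne_left (hr : IsRealization g OZ OT E x y w) (hO : IsGenericOrbit g G OZ OT)
    (hw : IsProperLabel E w) {v : ℕ → P ⊕ P} {k : ℕ} (hk : k ≠ 0)
    (hv : ∀ i < 2 * k, (bipGraph E).Adj (v i) (v (i + 1)))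
    (hb : ∀ i < 2 * k - 1, v i ≠ v (i + 2)) {a b : P} (ha : v 0 = Sum.inl a)
    (hb' : v (2 * k) = Sum.inl b) : x b ≠ x a := by
  have hl : ∀ i ≤ k, ∃ s, v (2 * i) = Sum.inl s := fun i hi => by
    rw [← Sum.isLeft_iff, bipGraph_isLeft_iff hv (by omega)]
    simp [ha]
  have hr' : ∀ i < k, ∃ s, v (2 * i + 1) = Sum.inr s := fun i hi => by
    rw [← Sum.isRight_iff, ← Sum.not_isLeft, bipGraph_isLeft_iff hv (by omega)]
    simp [ha]
  have := hO.ne_of_chain (xs := fun i => Sum.elim x (fun _ => x a) (v (2 * i)))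
    (u := fun i => edgeLabel w (v i) (v (i + 1))) hk ?_ ?_ ?_
  · simpa [ha, hb'] using this
  · simpa [hb'] using hr.mem_left b
  · intro i hi
    obtain ⟨s, hs⟩ := hl i hi.le
    obtain ⟨t, ht⟩ := hr' i hi
    obtain ⟨s', hs'⟩ := hl (i + 1) hi
    have h1 := hv (2 * i) (by omega)
    have h2 := hv (2 * i + 1) (by omega)
    rw [show 2 * (i + 1) = 2 * i + 1 + 1 by ring] at hs' ⊢
    rw [hs, ht] at h1
    rw [hs', ht] at h2
    simp only [hs, ht, hs', edgeLabel, Sum.elim_inl]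
    exact ⟨hr.mem_source _ _ h1, hr.mem_source _ _ h2,
      (hr.apply_eq _ _ h2).trans (hr.apply_eq _ _ h1).symm⟩
  · intro i hi
    exact hw.edgeLabel_ne (hv i (by omega)) (hv (i + 1) (by omega)) (hb i hi)

theorem IsRealization.ne_right (hr : IsRealization g OZ OT E x y w) (hO : IsGenericOrbit g G OZ OT)
    (hw : IsProperLabel E w) {v : ℕ → P ⊕ P} {k : ℕ} (hk : k ≠ 0)
    (hv : ∀ i < 2 * k, (bipGraph E).Adj (v i) (v (i + 1)))
    (hb : ∀ i < 2 * k - 1, v i ≠ v (i + 2)) {a b : P} (ha : v 0 = Sum.inr a)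
    (hb' : v (2 * k) = Sum.inr b) : y b ≠ y a := by
  intro hab
  obtain ⟨k, rfl⟩ := Nat.exists_eq_succ_of_ne_zero hk
  have hl : ∀ i ≤ k, ∃ s, v (2 * i + 1) = Sum.inl s := fun i hi => by
    rw [← Sum.isLeft_iff, bipGraph_isLeft_iff hv (by omega)]
    simp [ha]
  have hr' : ∀ i ≤ k + 1, ∃ s, v (2 * i) = Sum.inr s := fun i hi => by
    rw [← Sum.isRight_iff, ← Sum.not_isLeft, bipGraph_isLeft_iff hv (by omega)]
    simp [ha]
  obtain ⟨s, hs⟩ := hl 0 (by omega)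
  obtain ⟨s', hs'⟩ := hl k le_rfl
  rw [show 2 * k.succ = 2 * k + 1 + 1 by simp; ring] at hb'
  have h1 : E s a := by simpa [ha, hs] using hv 0 (by omega)
  have h2 : E s' b := by simpa [hb', hs'] using hv (2 * k + 1) (by omega)
  -- Suppose `y a = y b`. If the first and last edges have the same label, injectivity of that map
  -- gives `x s = x s'`, and the path without its two end edges contradicts `ne_left`, or is
  -- trivial. Otherwise, identifying `y b` with `y a` closes the path into a cycle based at `x s`,
  -- whose word ends with the two distinct labels `w s' b` and `w s a` and so is reduced.
  by_cases hlab : w s a = w s' b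
  · by_cases hk0 : k = 0
    · subst hk0
      have : s = s' := Sum.inl_injective (hs.symm.trans hs')
      subst this
      have := hw.right _ _ _ h1 h2 hlab
      subst this
      exact hb 0 (by omega) (ha.trans hb'.symm)
    · refine hr.ne_left hO hw (v := fun i => v (i + 1)) hk0 (fun i hi => hv _ (by omega))
        (fun i hi => hb _ (by omega)) hs hs' ?_
      have h3 := hr.mem_source _ _ h1
      have h4 := hr.mem_source _ _ h2
      have h5 := hr.apply_eq _ _ h1
      have h6 := hr.apply_eq _ _ h2
      rw [hlab] at h3 h5
      exact (g _ _).injOn h4 h3 (h6.trans (hab.trans h5.symm))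
  · have := hO.ne_of_chain (k := k + 1)
      (xs := fun i => if i = k + 1 then x s else Sum.elim x (fun _ => x a) (v (2 * i + 1)))
      (u := fun i => if i = 2 * k + 1 then w s a else edgeLabel w (v (i + 1)) (v (i + 2)))
      (by omega) ?_ ?_ ?_
    · simp [hs] at this
    · simpa using hr.mem_left s
    · intro i hi
      by_cases hik : i = k
      · subst hik
        simp [hs', hb', edgeLabel, hr.mem_source _ _ h1, hr.mem_source _ _ h2,
          hr.apply_eq _ _ h1, hr.apply_eq _ _ h2, hab]
      · obtain ⟨p, hp⟩ := hl i (by omega)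
        obtain ⟨t, ht⟩ := hr' (i + 1) (by omega)
        obtain ⟨p', hp'⟩ := hl (i + 1) (by omega)
        have h1 := hv (2 * i + 1) (by omega)
        have h2 := hv (2 * i + 2) (by omega)
        rw [show 2 * (i + 1) = 2 * i + 2 by ring] at hp' ht
        rw [hp, ht] at h1
        rw [hp', ht] at h2
        have e1 : 2 * i ≠ 2 * k + 1 := by omega
        have e2 : 2 * i + 1 ≠ 2 * k + 1 := by omega
        have e3 : i ≠ k + 1 := by omega
        have e4 : i + 1 ≠ k + 1 := by omega
        simp only [if_neg e1, if_neg e2, if_neg e3, if_neg e4]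
        rw [show 2 * (i + 1) + 1 = 2 * i + 2 + 1 by ring,
          show 2 * i + 1 + 1 = 2 * i + 2 by ring, show 2 * i + 1 + 2 = 2 * i + 2 + 1 by ring]
        simp only [hp, ht, hp', edgeLabel, Sum.elim_inl]
        exact ⟨hr.mem_source _ _ h1, hr.mem_source _ _ h2,
          (hr.apply_eq _ _ h2).trans (hr.apply_eq _ _ h1).symm⟩
    · intro i hi
      have e1 : i ≠ 2 * k + 1 := by omega
      simp only [if_neg e1]
      by_cases hik : i = 2 * k
      · subst hik
        simpa [hs', hb', edgeLabel] using fun h => hlab h.symm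
      · have e2 : i + 1 ≠ 2 * k + 1 := by omega
        rw [if_neg e2]
        exact hw.edgeLabel_ne (hv _ (by omega)) (hv _ (by omega)) (hb _ (by omega))

theorem IsRealization.injective (hr : IsRealization g OZ OT E x y w)
    (hO : IsGenericOrbit g G OZ OT) (hw : IsProperLabel E w) (hE : (bipGraph E).Connected) :
    Function.Injective x ∧ Function.Injective y := by
  have key : ∀ a b : P ⊕ P, a ≠ b → a.isLeft = b.isLeft → ∃ v : ℕ → P ⊕ P, ∃ k, k ≠ 0 ∧
      (∀ i < 2 * k, (bipGraph E).Adj (v i) (v (i + 1))) ∧ (∀ i < 2 * k - 1, v i ≠ v (i + 2)) ∧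
      v 0 = a ∧ v (2 * k) = b := by
    intro a b hab hs
    obtain ⟨p, hp⟩ := (hE.preconnected a b).exists_isPath
    have hadj : ∀ i < p.length, (bipGraph E).Adj (p.getVert i) (p.getVert (i + 1)) :=
      fun i hi => p.adj_getVert_succ hi
    -- The ends lie on the same side, and each edge changes side.
    have heven : Even p.length := by
      have := bipGraph_isLeft_iff hadj le_rfl
      rw [p.getVert_length, p.getVert_zero, hs] at this
      tauto
    obtain ⟨k, hk⟩ := heven.two_dvd
    refine ⟨p.getVert, k, ?_, fun i hi => hadj i (by omega), fun i hi h => ?_, p.getVert_zero, ?_⟩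
    · rintro rfl
      exact hab (SimpleGraph.Walk.eq_of_length_eq_zero hk)
    · have := hp.getVert_injOn (show i ≤ p.length by omega) (show i + 2 ≤ p.length by omega) h
      omega
    · rw [← hk, p.getVert_length]
  constructor
  · intro a b h
    by_contra hab
    obtain ⟨v, k, hk, h1, h2, h3, h4⟩ := key (Sum.inl a) (Sum.inl b) (by simpa using hab) rfl
    exact hr.ne_left hO hw hk h1 h2 h3 h4 h.symm
  · intro a b h
    by_contra hab
    obtain ⟨v, k, hk, h1, h2, h3, h4⟩ := key (Sum.inr a) (Sum.inr b) (by simpa using hab) rfl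
    exact hr.ne_right hO hw hk h1 h2 h3 h4 h.symm

end Realizations

/-! ### Extending a realization to a tree lying above -/

section Extension

variable {Z : Type*} {T : Type*} [TopologicalSpace Z] [TopologicalSpace T] {P Q : Type*}

/-- The conditions on a realization of `E'` over a realization of `E`, restricted to the vertices in
`S`: the point at `q` is in the prescribed neighborhood, an edge whose ends have the same
colour inherits its label, and the other edges have pairwise distinct labels, of first coordinate
larger than `M`. -/
structure IsPartialLift (g : ℕ → ℕ → OpenPartialHomeomorph Z T) (OZ : Set Z) (OT : Set T)
    (w : P → P → ℕ × ℕ) (π : Q → P) (c : Q → ℕ) (E' : Q → Q → Prop) (M : ℕ)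
    (N : P → Set Z) (N' : P → Set T) (S : Set (Q ⊕ Q))
    (x' : Q → Z) (y' : Q → T) (w' : Q → Q → ℕ × ℕ) : Prop where
  mem_left : ∀ q, Sum.inl q ∈ S → x' q ∈ OZ ∩ N (π q)
  mem_right : ∀ r, Sum.inr r ∈ S → y' r ∈ OT ∩ N' (π r)
  edge : ∀ q r, Sum.inl q ∈ S → Sum.inr r ∈ S → E' q r →
    x' q ∈ (g (w' q r).1 (w' q r).2).source ∧ g (w' q r).1 (w' q r).2 (x' q) = y' r ∧
    (c q = c r → w' q r = w (π q) (π r)) ∧ (c q ≠ c r → M < (w' q r).1)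
  fresh : ∀ q r q₁ r₁, Sum.inl q ∈ S → Sum.inr r ∈ S → E' q r → Sum.inl q₁ ∈ S → Sum.inr r₁ ∈ S →
    E' q₁ r₁ → c q ≠ c r → c q₁ ≠ c r₁ → w' q r = w' q₁ r₁ → q = q₁ ∧ r = r₁

variable {g : ℕ → ℕ → OpenPartialHomeomorph Z T} {G : Set Z} {OZ : Set Z} {OT : Set T}
  {E : P → P → Prop} {x : P → Z} {y : P → T} {w : P → P → ℕ × ℕ}

/-- This leaves room for one more leaf: a point placed in a shrunk neighborhood can be moved along
any edge of `E`, in either direction, and still land in the original neighborhood. -/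
theorem IsRealization.exists_shrink [Finite P] (hr : IsRealization g OZ OT E x y w)
    {N : P → Set Z} {N' : P → Set T}
    (hN : ∀ s, IsOpen (N s) ∧ x s ∈ N s) (hN' : ∀ t, IsOpen (N' t) ∧ y t ∈ N' t) :
    ∃ (N₁ : P → Set Z) (N₁' : P → Set T), (∀ s, IsOpen (N₁ s) ∧ x s ∈ N₁ s ∧ N₁ s ⊆ N s) ∧
      (∀ t, IsOpen (N₁' t) ∧ y t ∈ N₁' t ∧ N₁' t ⊆ N' t) ∧
      (∀ s t, E s t → ∀ z ∈ N₁ s, z ∈ (g (w s t).1 (w s t).2).source ∧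
        g (w s t).1 (w s t).2 z ∈ N' t) ∧
      (∀ s t, E s t → ∀ z ∈ N₁' t, z ∈ (g (w s t).1 (w s t).2).target ∧
        (g (w s t).1 (w s t).2).symm z ∈ N s) := by
  refine ⟨fun s => N s ∩ ⋂ t, ⋂ _ : E s t, ((g (w s t).1 (w s t).2).source ∩
      g (w s t).1 (w s t).2 ⁻¹' N' t),
    fun t => N' t ∩ ⋂ s, ⋂ _ : E s t, ((g (w s t).1 (w s t).2).target ∩
      (g (w s t).1 (w s t).2).symm ⁻¹' N s), fun s => ⟨?_, ?_, inter_subset_left⟩,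
      fun s => ⟨?_, ?_, inter_subset_left⟩, ?_, ?_⟩
  · exact (hN s).1.inter (isOpen_iInter_of_finite fun t => isOpen_iInter_of_finite fun _ =>
      (g _ _).isOpen_inter_preimage (hN' t).1)
  · refine ⟨(hN s).2, mem_iInter₂.2 fun t hst => ⟨hr.mem_source _ _ hst, ?_⟩⟩
    rw [mem_preimage, hr.apply_eq _ _ hst]
    exact (hN' t).2
  · exact (hN' s).1.inter (isOpen_iInter_of_finite fun t => isOpen_iInter_of_finite fun _ =>
      (g _ _).isOpen_inter_preimage_symm (hN t).1)
  · refine ⟨(hN' s).2, mem_iInter₂.2 fun t hst => ?_⟩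
    rw [← hr.apply_eq _ _ hst]
    refine ⟨(g _ _).map_source (hr.mem_source _ _ hst), ?_⟩
    rw [mem_preimage, (g _ _).left_inv (hr.mem_source _ _ hst)]
    exact (hN t).2
  · intro s t hst z hz
    exact mem_iInter₂.1 hz.2 t hst
  · intro s t hst z hz
    exact mem_iInter₂.1 hz.2 s hst

theorem IsRealization.exists_isPartialLift [Finite P] [Finite Q]
    (hr : IsRealization g OZ OT E x y w) (hO : IsGenericOrbit g G OZ OT)
    {π : Q → P} (c : Q → ℕ) {E' : Q → Q → Prop} (hE' : (bipGraph E').IsTree)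
    (hEE' : ∀ q r, E' q r → E (π q) (π r)) (M : ℕ) {N : P → Set Z} {N' : P → Set T}
    (hN : ∀ s, IsOpen (N s) ∧ x s ∈ N s) (hN' : ∀ t, IsOpen (N' t) ∧ y t ∈ N' t) :
    ∃ x' y' w', IsPartialLift g OZ OT w π c E' M N N' univ x' y' w' := by
  -- The neighborhoods must vary in the induction, since adding a leaf uses the induction hypothesis
  -- for smaller ones.
  suffices h : ∀ (N : P → Set Z) (N' : P → Set T), (∀ s, IsOpen (N s) ∧ x s ∈ N s) →
      (∀ t, IsOpen (N' t) ∧ y t ∈ N' t) →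
      ∃ x' y' w', IsPartialLift g OZ OT w π c E' M N N' univ x' y' w' from h N N' hN hN'
  clear hN hN' N N'
  classical
  refine hE'.grow_induction (p := fun S => ∀ (N : P → Set Z) (N' : P → Set T),
      (∀ s, IsOpen (N s) ∧ x s ∈ N s) → (∀ t, IsOpen (N' t) ∧ y t ∈ N' t) →
      ∃ x' y' w', IsPartialLift g OZ OT w π c E' M N N' S x' y' w') ?_ ?_
  · intro a N N' hN hN'
    refine ⟨x ∘ π, y ∘ π, fun _ _ => 0, fun q _ => ⟨hr.mem_left _, (hN _).2⟩,
      fun q _ => ⟨hr.mem_right _, (hN' _).2⟩, ?_, ?_⟩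
    · rintro q r rfl h
      simp at h
    · rintro q r _ _ rfl h
      simp at h
  · intro S v b ih hbS hvS hvb huniq N N' hN hN'
    obtain ⟨N₁, N₁', hN₁, hN₁', hmap, hmap'⟩ := hr.exists_shrink hN hN'
    obtain ⟨x', y', w', hl⟩ := ih N₁ N₁' (fun s => ⟨(hN₁ s).1, (hN₁ s).2.1⟩)
      (fun s => ⟨(hN₁' s).1, (hN₁' s).2.1⟩)
    -- A label beyond `M'` differs from every label used so far.
    obtain ⟨M', hM'⟩ : ∃ M', M ≤ M' ∧ ∀ q r, (w' q r).1 ≤ M' := by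
      obtain ⟨K, hK⟩ := (Set.finite_range fun p : Q × Q => (w' p.1 p.2).1).bddAbove
      exact ⟨max M K, le_max_left _ _, fun q r => (hK ⟨(q, r), rfl⟩).trans (le_max_right _ _)⟩
    rcases v with q₀ | r₀ <;> rcases b with q₁ | r₁ <;>
      simp only [bipGraph_inl_inl, bipGraph_inl_inr, bipGraph_inr_inl, bipGraph_inr_inr] at hvb
    · obtain ⟨hyO, hyN⟩ := hl.mem_right r₁ hbS
      obtain ⟨hyt, hyN'⟩ := hmap' _ _ (hEE' _ _ hvb) _ hyN
      set w₀ := w (π q₀) (π r₁)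
      set z := (g w₀.1 w₀.2).symm (y' r₁) with hz
      have hzs : z ∈ (g w₀.1 w₀.2).source := (g w₀.1 w₀.2).map_target hyt
      have hgz : g w₀.1 w₀.2 z = y' r₁ := (g w₀.1 w₀.2).right_inv hyt
      have hzO : z ∈ OZ := hO.map_symm _ hyO _ hyt
      obtain ⟨w₁, z₁, hz₁O, hz₁N, hz₁s, hz₁e, hd, hf⟩ : ∃ w₁ : ℕ × ℕ, ∃ z₁ ∈ OZ, z₁ ∈ N (π q₀) ∧
          z₁ ∈ (g w₁.1 w₁.2).source ∧ g w₁.1 w₁.2 z₁ = y' r₁ ∧ (c q₀ = c r₁ → w₁ = w₀) ∧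
          (c q₀ ≠ c r₁ → M' < w₁.1) := by
        by_cases hc : c q₀ = c r₁
        · exact ⟨w₀, z, hzO, hyN', hzs, hgz, fun _ => rfl, fun h => absurd hc h⟩
        · obtain ⟨w₁, hw₁, z₁, hz₁, hz₁s, he⟩ := hO.accumulate_symm z hzO w₀ hzs _ (hN _).1 hyN' M'
          refine ⟨w₁, z₁, ?_, hz₁, hz₁s, he.trans hgz, fun h => absurd h hc, fun _ => hw₁⟩
          -- The new point is in the orbit because it is the preimage of the orbit point `y' r₁`.
          have h1 := hO.map_symm (g w₁.1 w₁.2 z₁) (by rwa [he, hgz]) w₁ ((g _ _).map_source hz₁s)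
          rwa [(g w₁.1 w₁.2).left_inv hz₁s] at h1
      have hu : ∀ r, Sum.inr r ∈ insert (Sum.inl q₀) S → E' q₀ r → r = r₁ := by
        intro r hr' hE
        have h1 : Sum.inr r ∈ S := by simpa using hr'
        exact Sum.inr_injective (huniq _ h1 hE)
      have hS : ∀ q, q ≠ q₀ → Sum.inl q ∈ insert (Sum.inl q₀) S → Sum.inl q ∈ S := by
        intro q hq h
        simpa [hq] using h
      have hS' : ∀ r, Sum.inr r ∈ insert (Sum.inl q₀) S → Sum.inr r ∈ S := by
        intro r h
        simpa using h
      refine ⟨Function.update x' q₀ z₁, y', fun q r => if q = q₀ then w₁ else w' q r, ?_, ?_,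
        ?_, ?_⟩
      · intro q hq
        by_cases h : q = q₀
        · subst h
          simpa using ⟨hz₁O, hz₁N⟩
        · rw [Function.update_of_ne h]
          exact ⟨(hl.mem_left q (hS q h hq)).1, (hN₁ _).2.2 (hl.mem_left q (hS q h hq)).2⟩
      · intro r hr'
        exact ⟨(hl.mem_right r (hS' r hr')).1, (hN₁' _).2.2 (hl.mem_right r (hS' r hr')).2⟩
      · intro q r hq hr' hE
        by_cases h : q = q₀
        · subst h
          obtain rfl := hu r hr' hE
          simp only [if_true, Function.update_self]
          exact ⟨hz₁s, hz₁e, hd, fun h => hM'.1.trans_lt (hf h)⟩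
        · simp only [if_neg h, Function.update_of_ne h]
          exact hl.edge q r (hS q h hq) (hS' r hr') hE
      · intro q r q' r' hq hr' hE hq' hr'' hE' hc hc' he
        by_cases h : q = q₀ <;> by_cases h' : q' = q₀
        · subst h h'
          exact ⟨rfl, (hu r hr' hE).trans (hu r' hr'' hE').symm⟩
        · subst h
          obtain rfl := hu r hr' hE
          simp only [if_true, if_neg h'] at he
          have := hf hc
          rw [he] at this
          exact absurd this (not_lt.2 (hM'.2 _ _))
        · subst h'
          obtain rfl := hu r' hr'' hE'
          simp only [if_true, if_neg h] at he
          have := hf hc'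
          rw [← he] at this
          exact absurd this (not_lt.2 (hM'.2 _ _))
        · simp only [if_neg h, if_neg h'] at he
          exact hl.fresh q r q' r' (hS q h hq) (hS' r hr') hE (hS q' h' hq') (hS' r' hr'') hE'
            hc hc' he
    · obtain ⟨hxO, hxN⟩ := hl.mem_left q₁ hbS
      obtain ⟨hxs, hxN'⟩ := hmap _ _ (hEE' _ _ hvb) _ hxN
      set w₀ := w (π q₁) (π r₀)
      obtain ⟨w₁, hw₁s, hw₁N, hd, hf⟩ : ∃ w₁ : ℕ × ℕ, x' q₁ ∈ (g w₁.1 w₁.2).source ∧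
          g w₁.1 w₁.2 (x' q₁) ∈ N' (π r₀) ∧ (c q₁ = c r₀ → w₁ = w₀) ∧
          (c q₁ ≠ c r₀ → M' < w₁.1) := by
        by_cases hc : c q₁ = c r₀
        · exact ⟨w₀, hxs, hxN', fun _ => rfl, fun h => absurd hc h⟩
        · obtain ⟨w₁, hw₁, hs, hm⟩ := hO.accumulate _ hxO w₀ hxs _ (hN' _).1 hxN' M'
          exact ⟨w₁, hs, hm, fun h => absurd h hc, fun _ => hw₁⟩
      have hu : ∀ q, Sum.inl q ∈ insert (Sum.inr r₀) S → E' q r₀ → q = q₁ := by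
        intro q hq hE
        have h1 : Sum.inl q ∈ S := by simpa using hq
        exact Sum.inl_injective (huniq _ h1 hE)
      have hS : ∀ r, r ≠ r₀ → Sum.inr r ∈ insert (Sum.inr r₀) S → Sum.inr r ∈ S := by
        intro r hr' h
        simpa [hr'] using h
      have hS' : ∀ q, Sum.inl q ∈ insert (Sum.inr r₀) S → Sum.inl q ∈ S := by
        intro q h
        simpa using h
      refine ⟨x', Function.update y' r₀ (g w₁.1 w₁.2 (x' q₁)),
        fun q r => if r = r₀ then w₁ else w' q r, ?_, ?_, ?_, ?_⟩
      · intro q hq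
        exact ⟨(hl.mem_left q (hS' q hq)).1, (hN₁ _).2.2 (hl.mem_left q (hS' q hq)).2⟩
      · intro r hr'
        by_cases h : r = r₀
        · subst h
          simpa using ⟨hO.map _ hxO _ hw₁s, hw₁N⟩
        · rw [Function.update_of_ne h]
          exact ⟨(hl.mem_right r (hS r h hr')).1, (hN₁' _).2.2 (hl.mem_right r (hS r h hr')).2⟩
      · intro q r hq hr' hE
        by_cases h : r = r₀
        · subst h
          obtain rfl := hu q hq hE
          simp only [if_true, Function.update_self]
          exact ⟨hw₁s, trivial, hd, fun h => hM'.1.trans_lt (hf h)⟩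
        · simp only [if_neg h, Function.update_of_ne h]
          exact hl.edge q r (hS' q hq) (hS r h hr') hE
      · intro q r q' r' hq hr' hE hq' hr'' hE' hc hc' he
        by_cases h : r = r₀ <;> by_cases h' : r' = r₀
        · subst h h'
          exact ⟨(hu q hq hE).trans (hu q' hq' hE').symm, rfl⟩
        · subst h
          obtain rfl := hu q hq hE
          simp only [if_true, if_neg h'] at he
          have := hf hc
          rw [he] at this
          exact absurd this (not_lt.2 (hM'.2 _ _))
        · subst h'
          obtain rfl := hu q' hq' hE'
          simp only [if_true, if_neg h] at he
          have := hf hc'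
          rw [← he] at this
          exact absurd this (not_lt.2 (hM'.2 _ _))
        · simp only [if_neg h, if_neg h'] at he
          exact hl.fresh q r q' r' (hS' q hq) (hS r h hr') hE (hS' q' hq') (hS r' h' hr'') hE'
            hc hc' he

/-- Extension of a realization of `E` to a realization of a tree `E'` lying over `E`, near the
given one. -/
theorem IsRealization.exists_lift [Finite P] [Finite Q]
    (hr : IsRealization g OZ OT E x y w) (hO : IsGenericOrbit g G OZ OT)
    (hx : Function.Injective x) (hy : Function.Injective y)
    {π : Q → P} {c : Q → ℕ} (hπc : ∀ q r, π q = π r → c q = c r → q = r)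
    {E' : Q → Q → Prop} (hE' : (bipGraph E').IsTree)
    (hEE' : ∀ q r, E' q r → E (π q) (π r)) (M : ℕ) {N : P → Set Z} {N' : P → Set T}
    (hN : ∀ s, IsOpen (N s) ∧ x s ∈ N s) (hN' : ∀ t, IsOpen (N' t) ∧ y t ∈ N' t) :
    ∃ x' y' w', IsRealization g OZ OT E' x' y' w' ∧ Function.Injective x' ∧
      Function.Injective y' ∧ (∀ q, x' q ∈ N (π q)) ∧ (∀ r, y' r ∈ N' (π r)) ∧
      (∀ q r, E' q r → c q = c r → w' q r = w (π q) (π r)) ∧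
      (∀ q r, E' q r → c q ≠ c r → M < (w' q r).1) := by
  -- Going beyond the labels of the old realization keeps new labels apart from inherited ones.
  obtain ⟨M', hM'⟩ : ∃ M', M ≤ M' ∧ ∀ q r, (w q r).1 ≤ M' := by
    obtain ⟨K, hK⟩ := (Set.finite_range fun p : P × P => (w p.1 p.2).1).bddAbove
    exact ⟨max M K, le_max_left _ _, fun q r => (hK ⟨(q, r), rfl⟩).trans (le_max_right _ _)⟩
  obtain ⟨x', y', w', hl⟩ := hr.exists_isPartialLift hO c hE' hEE' M' hN hN'
  have hr' : IsRealization g OZ OT E' x' y' w' :=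
    ⟨fun s => (hl.mem_left s trivial).1, fun s => (hl.mem_right s trivial).1,
      fun s t h => (hl.edge s t trivial trivial h).1,
      fun s t h => (hl.edge s t trivial trivial h).2.1⟩
  have hdiag : ∀ q r, E' q r → c q = c r → w' q r = w (π q) (π r) :=
    fun q r h => (hl.edge q r trivial trivial h).2.2.1
  have hfresh : ∀ q r, E' q r → c q ≠ c r → M' < (w' q r).1 :=
    fun q r h => (hl.edge q r trivial trivial h).2.2.2
  have hne : ∀ q r q₁ r₁, E' q r → E' q₁ r₁ → c q = c r → c q₁ ≠ c r₁ → w' q r ≠ w' q₁ r₁ := by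
    intro q r q₁ r₁ h h₁ hc hc₁ he
    have h2 := hfresh _ _ h₁ hc₁
    rw [← he, hdiag _ _ h hc] at h2
    exact absurd h2 (not_lt.2 (hM'.2 _ _))
  -- Only two inherited labels need an argument. If they agree at a common vertex, injectivity of
  -- `x` and `y` gives the other ends the same projection; their colours also agree, so they
  -- coincide by `hπc`.
  have hw' : IsProperLabel E' w' := by
    constructor
    · intro q r r' h h' he
      by_cases hc : c q = c r <;> by_cases hc' : c q = c r'
      · refine hπc _ _ (hy ?_) (hc.symm.trans hc')
        rw [hdiag _ _ h hc, hdiag _ _ h' hc'] at he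
        rw [← hr.apply_eq _ _ (hEE' _ _ h), ← hr.apply_eq _ _ (hEE' _ _ h'), he]
      · exact absurd he (hne _ _ _ _ h h' hc hc')
      · exact absurd he.symm (hne _ _ _ _ h' h hc' hc)
      · exact (hl.fresh _ _ _ _ trivial trivial h trivial trivial h' hc hc' he).2
    · intro q q' r h h' he
      by_cases hc : c q = c r <;> by_cases hc' : c q' = c r
      · refine hπc _ _ (hx ?_) (hc.trans hc'.symm)
        rw [hdiag _ _ h hc, hdiag _ _ h' hc'] at he
        have h1 := hr.mem_source _ _ (hEE' _ _ h)
        have h2 := hr.apply_eq _ _ (hEE' _ _ h)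
        rw [he] at h1 h2
        exact (g _ _).injOn h1 (hr.mem_source _ _ (hEE' _ _ h'))
          (h2.trans (hr.apply_eq _ _ (hEE' _ _ h')).symm)
      · exact absurd he (hne _ _ _ _ h h' hc hc')
      · exact absurd he.symm (hne _ _ _ _ h' h hc' hc)
      · exact (hl.fresh _ _ _ _ trivial trivial h trivial trivial h' hc hc' he).1
  obtain ⟨hx', hy'⟩ := hr'.injective hO hw' hE'.connected
  exact ⟨x', y', w', hr', hx', hy', fun q => (hl.mem_left q trivial).2,
    fun q => (hl.mem_right q trivial).2, hdiag,
    fun q r h hc => hM'.1.trans_lt (hfresh q r h hc)⟩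

end Extension

/-! ### Finite sequences, the forest `R`, and limits of the graphs -/

section DeparturePositions

/-- The finite sequences of length `l` in `⋃_p ∏_{i<p} A_i`. -/
abbrev FinSeqOfLength (A : ℕ → Finset ℕ) (l : ℕ) : Type :=
  {s : List ℕ // s.length = l ∧ IsFinSeq A s}

variable {A : ℕ → Finset ℕ}

/-- The restriction of `x` to its first `l` coordinates. -/
def SeqProd.restrict (x : SeqProd A) (l : ℕ) : FinSeqOfLength A l :=
  ⟨(List.range l).map x.1, by simp, fun i h => by simpa using x.2 i⟩

theorem SeqProd.restrict_eq_iff {x y : SeqProd A} {l : ℕ} :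
    x.restrict l = y.restrict l ↔ ∀ i < l, x.1 i = y.1 i := by
  rw [SeqProd.restrict, SeqProd.restrict, Subtype.mk.injEq, List.map_inj_left]
  simp

/-- Removal of the last term. -/
def FinSeqOfLength.init {l : ℕ} (q : FinSeqOfLength A (l + 1)) : FinSeqOfLength A l :=
  ⟨q.1.dropLast, by simp [q.2.1], fun i h => by
    rw [List.getElem_dropLast]
    exact q.2.2 i (by simp at h; omega)⟩

/-- The last term. -/
def FinSeqOfLength.last {l : ℕ} (q : FinSeqOfLength A (l + 1)) : ℕ :=
  q.1[l]'(by rw [q.2.1]; omega)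

theorem FinSeqOfLength.ext_init_last {l : ℕ} {q r : FinSeqOfLength A (l + 1)}
    (h : q.init = r.init) (h' : q.last = r.last) : q = r := by
  have e : ∀ q : FinSeqOfLength A (l + 1), q.1 = q.init.1 ++ [q.last] := by
    intro q
    have hne : q.1 ≠ [] := by
      intro h
      simpa [h] using q.2.1
    conv_lhs => rw [← List.dropLast_append_getLast hne]
    simp [FinSeqOfLength.init, FinSeqOfLength.last, List.getLast_eq_getElem, q.2.1]
  exact Subtype.ext (by rw [e q, e r, h, h'])

@[simp] theorem SeqProd.init_restrict (x : SeqProd A) (l : ℕ) :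
    (x.restrict (l + 1)).init = x.restrict l := by
  apply Subtype.ext
  simp [SeqProd.restrict, FinSeqOfLength.init, List.range_succ]

@[simp] theorem SeqProd.last_restrict (x : SeqProd A) (l : ℕ) :
    (x.restrict (l + 1)).last = x.1 l := by
  simp [SeqProd.restrict, FinSeqOfLength.last]

theorem SeqProd.restrict_succ (x : SeqProd A) (l : ℕ) :
    (x.restrict (l + 1)).1 = (x.restrict l).1 ++ [x.1 l] := by
  simp [SeqProd.restrict, List.range_succ]

theorem SeqProd.mem_cylinderSet_iff {x : SeqProd A} {l : ℕ} {s : FinSeqOfLength A l} :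
    x ∈ cylinderSet A s.1 ↔ x.restrict l = s := by
  constructor
  · intro h
    apply Subtype.ext
    refine List.ext_getElem (by simp [SeqProd.restrict, s.2.1]) fun i h1 h2 => ?_
    simpa [SeqProd.restrict] using h i h2
  · rintro rfl i hi
    simp [SeqProd.restrict]

instance (l : ℕ) : Finite (FinSeqOfLength A l) := by
  induction l with
  | zero =>
    refine @Finite.of_subsingleton _ ⟨fun s t => Subtype.ext ?_⟩
    rw [List.eq_nil_of_length_eq_zero s.2.1, List.eq_nil_of_length_eq_zero t.2.1]
  | succ l ih =>
    refine Finite.of_injective (β := FinSeqOfLength A l × A l)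
      (fun q => (q.init, ⟨q.last, q.2.2 l (by rw [q.2.1]; omega)⟩)) fun q r h => ?_
    rw [Prod.mk.injEq] at h
    exact FinSeqOfLength.ext_init_last h.1 (Subtype.mk.injEq .. ▸ h.2)

theorem SeqProd.exists_restrict_eq [Nonempty (SeqProd A)] {l : ℕ} (s : FinSeqOfLength A l) :
    ∃ x : SeqProd A, x.restrict l = s := by
  obtain ⟨x⟩ := ‹Nonempty (SeqProd A)›
  refine ⟨⟨fun i => if h : i < s.1.length then s.1[i] else x.1 i, fun i => ?_⟩, ?_⟩
  · by_cases h : i < s.1.length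
    · simpa [h] using s.2.2 i h
    · simpa [h] using x.2 i
  · rw [← SeqProd.mem_cylinderSet_iff]
    intro i h
    simp [h]

theorem FinSeqOfLength.init_surjective [Nonempty (SeqProd A)] (l : ℕ) :
    Function.Surjective (FinSeqOfLength.init : FinSeqOfLength A (l + 1) → _) := by
  intro s
  obtain ⟨x, rfl⟩ := SeqProd.exists_restrict_eq s
  exact ⟨x.restrict (l + 1), by simp⟩

theorem SeqProd.isOpen_restrict_eq (x : SeqProd A) (l : ℕ) :
    IsOpen {y : SeqProd A | y.restrict l = x.restrict l} := by
  have : {y : SeqProd A | y.restrict l = x.restrict l} = ⋂ i ∈ Finset.range l,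
      (fun y : SeqProd A => y.1 i) ⁻¹' {x.1 i} := by
    ext y
    simp [SeqProd.restrict_eq_iff]
  rw [this]
  exact isOpen_biInter_finset fun i _ =>
    (isOpen_discrete _).preimage ((continuous_apply i).comp continuous_subtype_val)

theorem SeqProd.tendsto_of_restrict_eq {x : SeqProd A} {xs : ℕ → SeqProd A}
    (h : ∀ l, (xs l).restrict l = x.restrict l) : Tendsto xs atTop (𝓝 x) := by
  rw [tendsto_subtype_rng, tendsto_pi_nhds]
  intro i
  refine tendsto_const_nhds.congr' ?_
  filter_upwards [eventually_gt_atTop i] with l hl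
  exact (SeqProd.restrict_eq_iff.1 (h l) i hl).symm

theorem SeqProd.restrict_le_of_lt {x y : SeqProd A} (h : toLex x.1 < toLex y.1) (l : ℕ) :
    (x.restrict l).1 ≤ (y.restrict l).1 := by
  obtain ⟨i, h1, h2⟩ := h
  by_cases hi : i < l
  · have hlen : ∀ z : SeqProd A, i < (z.restrict l).1.length := fun z => by
      rwa [(z.restrict l).2.1]
    refine le_of_lt (List.lt_iff_exists.2 (Or.inr ⟨i, hlen x, hlen y, fun j hj => ?_, ?_⟩))
    · simpa [SeqProd.restrict] using h1 j hj
    · simpa [SeqProd.restrict] using h2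
  · rw [SeqProd.restrict_eq_iff.2 fun j hj => h1 j (by omega)]

variable {f : ℕ → ℕ → OpenPartialHomeomorph (SeqProd A) (SeqProd A)}

theorem IsDepartureSituation.relAt_restrict (hf : IsDepartureSituation A f) {n : ℕ}
    {x y : SeqProd A} (h : (x, y) ∈ gluedGraph f n) (l : ℕ) :
    RelAt A f n (x.restrict l).1 (y.restrict l).1 :=
  ⟨(x.restrict l).2.2, (y.restrict l).2.2, (x.restrict l).2.1.trans (y.restrict l).2.1.symm,
    SeqProd.restrict_le_of_lt (hf.lex_lt n x y h) l, (x, y),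
    ⟨SeqProd.mem_cylinderSet_iff.2 rfl, SeqProd.mem_cylinderSet_iff.2 rfl⟩, h⟩

theorem RelAt.exists_restrict_eq {n l : ℕ} {s t : FinSeqOfLength A l} (h : RelAt A f n s.1 t.1) :
    ∃ x y : SeqProd A, (x, y) ∈ gluedGraph f n ∧ x.restrict l = s ∧ y.restrict l = t := by
  obtain ⟨-, -, -, -, ⟨x, y⟩, ⟨hx, hy⟩, hxy⟩ := h
  exact ⟨x, y, hxy, SeqProd.mem_cylinderSet_iff.1 hx, SeqProd.mem_cylinderSet_iff.1 hy⟩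

theorem IsDepartureSituation.graphRel_init (hf : IsDepartureSituation A f) {l : ℕ}
    {q r : FinSeqOfLength A (l + 1)} (h : GraphRel A f q.1 r.1) :
    GraphRel A f q.init.1 r.init.1 := by
  obtain ⟨n, hn⟩ := h
  obtain ⟨x, y, hxy, rfl, rfl⟩ := hn.exists_restrict_eq
  simpa using ⟨n, hf.relAt_restrict hxy l⟩

/-- A path between finite sequences of `⋃_p ∏_{i<p} A_i` is a chain without repetition, hence
unique. All other lists are isolated vertices. -/
theorem IsDepartureSituation.isAcyclic_fromRel (hf : IsDepartureSituation A f) :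
    (SimpleGraph.fromRel (GraphRel A f)).IsAcyclic := by
  have hfin : ∀ a b, (SimpleGraph.fromRel (GraphRel A f)).Adj a b → IsFinSeq A a ∧ IsFinSeq A b := by
    rintro a b ⟨-, ⟨n, h⟩ | ⟨n, h⟩⟩
    · exact ⟨h.1, h.2.1⟩
    · exact ⟨h.2.1, h.1⟩
  have hsupp : ∀ a b (p : (SimpleGraph.fromRel (GraphRel A f)).Walk a b), IsFinSeq A a →
      ∀ r ∈ p.support, IsFinSeq A r := by
    intro a b p
    induction p with
    | nil => simp
    | cons h p ih =>
      intro ha r hr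
      rcases List.mem_cons.1 (by simpa using hr) with rfl | hr
      · exact ha
      · exact ih (hfin _ _ h).2 r hr
  have hchain : ∀ a b (p : (SimpleGraph.fromRel (GraphRel A f)).Walk a b), IsFinSeq A a →
      IsChainFromTo A f p.support a b := by
    intro a b p ha
    refine ⟨hsupp a b p ha, p.isChain_adj_support.imp fun c d h => h.2, ?_, ?_⟩
    · rw [List.head?_eq_some_head p.support_ne_nil, p.head_support]
    · rw [List.getLast?_eq_some_getLast p.support_ne_nil, p.getLast_support]
  refine SimpleGraph.isAcyclic_iff_subsingleton_path.2 fun a b => ⟨fun p q => Subtype.ext ?_⟩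
  by_cases ha : IsFinSeq A a
  · refine SimpleGraph.Walk.ext_support ?_
    exact (hf.unique_chain a b ⟨_, hchain a b p.1 ha⟩).unique
      ⟨hchain a b p.1 ha, p.2.support_nodup⟩ ⟨hchain a b q.1 ha, q.2.support_nodup⟩
  · obtain ⟨p, hp⟩ := p
    obtain ⟨q, hq⟩ := q
    cases p with
    | nil => cases q with
      | nil => rfl
      | cons h _ => exact absurd (hfin _ _ h).1 ha
    | cons h _ => exact absurd (hfin _ _ h).1 ha

/-- Antisymmetry of `R`, needed for the doubling, comes from the lexicographic order in its
definition. -/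
theorem IsDepartureSituation.isAcyclic_bipGraph (hf : IsDepartureSituation A f) (l : ℕ) :
    (bipGraph fun s t : FinSeqOfLength A l => GraphRel A f s.1 t.1).IsAcyclic := by
  have h : (bipGraph (GraphRel A f)).IsAcyclic := by
    refine _root_.isAcyclic_bipGraph ?_ hf.isAcyclic_fromRel
    rintro s t ⟨n, h⟩ ⟨m, h'⟩
    exact le_antisymm h.2.2.2.1 h'.2.2.2.1
  refine h.comap ⟨Sum.map Subtype.val Subtype.val, ?_⟩
    (Sum.map_injective.2 ⟨Subtype.val_injective, Subtype.val_injective⟩)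
  rintro (a | a) (b | b) h <;> exact h

/-- If `x` and `y` eventually agree, a limit `(x, y)` of the graphs belongs to one of them. -/
theorem IsDepartureSituation.mem_unionGraph_of_eventually_eq (hf : IsDepartureSituation A f)
    {x y : SeqProd A} (hx : x ∈ commonDomain f)
    (h : ∀ l, GraphRel A f (x.restrict l).1 (y.restrict l).1) {l₀ : ℕ}
    (hxy : ∀ l ≥ l₀, x.1 l = y.1 l) : (x, y) ∈ unionGraph f := by
  set n := relIndex A f (x.restrict l₀).1 (y.restrict l₀).1 with hn
  -- Appending equal terms does not change `ψ`, so a single `n` serves all large `l`. Thus `(x, y)`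
  -- is a limit of points of the graph of `f_n`, which is continuous at `x`.
  have hidx : ∀ l ≥ l₀, relIndex A f (x.restrict l).1 (y.restrict l).1 = n := by
    intro l hl
    induction l, hl using Nat.le_induction with
    | base => rfl
    | succ l hl ih =>
      have h1 := h (l + 1)
      rw [x.restrict_succ, y.restrict_succ, ← hxy l hl] at h1 ⊢
      rw [hf.index_append _ _ _ h1, ih]
  have hrel : ∀ l ≥ l₀, RelAt A f n (x.restrict l).1 (y.restrict l).1 := by
    intro l hl
    rw [← hidx l hl]
    exact Nat.sInf_mem (s := {n | RelAt A f n _ _}) (h l)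
  have hrel' : ∀ l, ∃ a b : SeqProd A, (a, b) ∈ gluedGraph f n ∧ a.restrict l = x.restrict l ∧
      b.restrict l = y.restrict l := by
    intro l
    obtain ⟨a, b, hab, ha, hb⟩ := (hrel (max l l₀) (le_max_right _ _)).exists_restrict_eq
    rw [SeqProd.restrict_eq_iff] at ha hb
    exact ⟨a, b, hab, SeqProd.restrict_eq_iff.2 fun i hi => ha i (lt_max_of_lt_left hi),
      SeqProd.restrict_eq_iff.2 fun i hi => hb i (lt_max_of_lt_left hi)⟩
  choose a b hab ha hb using hrel'
  have ha' := SeqProd.tendsto_of_restrict_eq ha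
  have hb' := SeqProd.tendsto_of_restrict_eq hb
  obtain ⟨p, hp⟩ := mem_iUnion.1 (mem_iInter.1 hx n)
  refine mem_iUnion.2 ⟨n, p, hp, ?_⟩
  refine tendsto_nhds_unique (((f n p).continuousAt hp).tendsto.comp ha') (hb'.congr' ?_)
  filter_upwards [ha'.eventually ((f n p).open_source.mem_nhds hp)] with l hl
  obtain ⟨p', hp', he⟩ := hab l
  by_cases hpp : p' = p
  · subst hpp; exact he.symm
  · exact absurd hl ((hf.general.disjoint_sources n p' p hpp).notMem_of_mem_left hp')

theorem IsDepartureSituation.graphRel_of_tendsto (hf : IsDepartureSituation A f)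
    {x y : SeqProd A} {yk : ℕ → SeqProd A} (hy : Tendsto yk atTop (𝓝 y))
    (hxy : ∀ k, (x, yk k) ∈ unionGraph f) (l : ℕ) :
    GraphRel A f (x.restrict l).1 (y.restrict l).1 := by
  obtain ⟨k, hk⟩ := (hy.eventually ((y.isOpen_restrict_eq l).mem_nhds rfl)).exists
  obtain ⟨n, hn⟩ := mem_iUnion.1 (hxy k)
  have := hf.relAt_restrict hn l
  rw [show (yk k).restrict l = y.restrict l from hk] at this
  exact ⟨n, this⟩

/-- The injection defined by a scheme of vanishing closed balls indexed by finite sequences. -/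
theorem exists_continuous_injective_of_scheme {X : Type*} [MetricSpace X] [CompleteSpace X]
    (c : ∀ l, FinSeqOfLength A l → X) (ε : ℕ → ℝ) (hε : ∀ l, 0 < ε l) (hlim : Tendsto ε atTop (𝓝 0))
    (hsub : ∀ l q, Metric.closedBall (c (l + 1) q) (ε (l + 1)) ⊆
      Metric.closedBall (c l q.init) (ε l))
    (hdis : ∀ l (q r : FinSeqOfLength A (l + 1)), q ≠ r →
      Disjoint (Metric.closedBall (c (l + 1) q) (ε (l + 1)))
        (Metric.closedBall (c (l + 1) r) (ε (l + 1)))) :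
    ∃ u : SeqProd A → X, Continuous u ∧ Function.Injective u ∧
      (∀ x l, u x ∈ Metric.closedBall (c l (x.restrict l)) (ε l)) ∧
      ∀ x, Tendsto (fun l => c l (x.restrict l)) atTop (𝓝 (u x)) := by
  have hanti : ∀ x : SeqProd A, Antitone fun l =>
      Metric.closedBall (c l (x.restrict l)) (ε l) := by
    intro x
    refine antitone_nat_of_succ_le fun l => ?_
    simpa using hsub l (x.restrict (l + 1))
  have hmem : ∀ (x : SeqProd A) (l m : ℕ), l ≤ m →
      c m (x.restrict m) ∈ Metric.closedBall (c l (x.restrict l)) (ε l) :=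
    fun x l m hlm => hanti x hlm (Metric.mem_closedBall_self (hε m).le)
  have hcau : ∀ x : SeqProd A, CauchySeq fun l => c l (x.restrict l) := fun x =>
    cauchySeq_of_le_tendsto_0' ε (fun l m hlm => by
      simpa [dist_comm] using hmem x l m hlm) hlim
  choose u hu using fun x => cauchySeq_tendsto_of_complete (hcau x)
  have hball : ∀ x l, u x ∈ Metric.closedBall (c l (x.restrict l)) (ε l) := fun x l =>
    Metric.isClosed_closedBall.mem_of_tendsto (hu x)
      ((eventually_ge_atTop l).mono fun m hm => hmem x l m hm)
  refine ⟨u, ?_, ?_, hball, hu⟩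
  · rw [continuous_iff_continuousAt]
    intro x
    rw [Metric.continuousAt_iff']
    intro δ hδ
    obtain ⟨l, hl⟩ := (hlim.eventually (gt_mem_nhds (half_pos hδ))).exists
    filter_upwards [(x.isOpen_restrict_eq l).mem_nhds rfl] with y hy
    have h1 := hball y l
    rw [show y.restrict l = x.restrict l from hy] at h1
    have h2 := hball x l
    rw [Metric.mem_closedBall] at h1 h2
    linarith [dist_triangle_right (u y) (u x) (c l (x.restrict l))]
  · intro x y hxy
    by_contra hne
    obtain ⟨i, hi⟩ : ∃ i, x.1 i ≠ y.1 i := by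
      by_contra! h
      exact hne (Subtype.ext (funext h))
    refine (hdis i (x.restrict (i + 1)) (y.restrict (i + 1)) ?_).notMem_of_mem_left
      (hball x (i + 1)) (hxy ▸ hball y (i + 1))
    intro h
    exact hi (SeqProd.restrict_eq_iff.1 h i (by omega))

end DeparturePositions

/-! ### The inductive construction and the two injections -/

section Construction

variable {Z : Type*} {T : Type*} {A : ℕ → Finset ℕ}

/-- Two distinct labels form a reduced word of length two, which cannot fix `z`. -/
theorem IsGenericOrbit.apply_ne [TopologicalSpace Z] [TopologicalSpace T]
    {g : ℕ → ℕ → OpenPartialHomeomorph Z T} {G OZ : Set Z} {OT : Set T}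
    (hO : IsGenericOrbit g G OZ OT) {z : Z} (hz : z ∈ OZ)
    {w w' : ℕ × ℕ} (hw : z ∈ (g w.1 w.2).source) (hw' : z ∈ (g w'.1 w'.2).source) (hne : w ≠ w') :
    g w.1 w.2 z ≠ g w'.1 w'.2 z := by
  intro he
  refine hO.ne_of_chain (xs := fun _ => z) (u := fun i => if i = 0 then w else w') (k := 1)
    one_ne_zero hz (fun i hi => ?_) (fun i hi => ?_) rfl
  · obtain rfl : i = 0 := by omega
    simp [hw, hw', he]
  · obtain rfl : i = 0 := by omega
    simpa using hne

variable [MetricSpace Z] [MetricSpace T]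

/-- The stage of the construction that deals with the sequences of length `l`. -/
structure Stage (f : ℕ → ℕ → OpenPartialHomeomorph (SeqProd A) (SeqProd A))
    (g : ℕ → ℕ → OpenPartialHomeomorph Z T) (OZ : Set Z) (OT : Set T) (l : ℕ) where
  edge : FinSeqOfLength A l → FinSeqOfLength A l → Prop
  isTree : (bipGraph edge).IsTree
  edge_of_graphRel : ∀ s t, GraphRel A f s.1 t.1 → edge s t
  x : FinSeqOfLength A l → Z
  y : FinSeqOfLength A l → T
  label : FinSeqOfLength A l → FinSeqOfLength A l → ℕ × ℕ
  real : IsRealization g OZ OT edge x y label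
  x_injective : Function.Injective x
  y_injective : Function.Injective y
  radius : ℝ
  radius_pos : 0 < radius
  radius_le : radius ≤ (1 / 2) ^ l

variable {f : ℕ → ℕ → OpenPartialHomeomorph (SeqProd A) (SeqProd A)}
  {g : ℕ → ℕ → OpenPartialHomeomorph Z T} {G OZ : Set Z} {OT : Set T}

/-- The conditions relating two consecutive stages; `O` is an open set containing `G`. -/
structure Stage.IsNext {l : ℕ} (O : Set Z) (C : Stage f g OZ OT l)
    (C' : Stage f g OZ OT (l + 1)) : Prop where
  ball_x : ∀ q, Metric.closedBall (C'.x q) C'.radius ⊆ Metric.ball (C.x q.init) C.radius ∩ O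
  ball_y : ∀ q, Metric.closedBall (C'.y q) C'.radius ⊆ Metric.ball (C.y q.init) C.radius
  disjoint_x : ∀ q r, q ≠ r → Disjoint (Metric.closedBall (C'.x q) C'.radius)
    (Metric.closedBall (C'.x r) C'.radius)
  disjoint_y : ∀ q r, q ≠ r → Disjoint (Metric.closedBall (C'.y q) C'.radius)
    (Metric.closedBall (C'.y r) C'.radius)
  label_eq : ∀ q r, C'.edge q r → q.last = r.last → C'.label q r = C.label q.init r.init
  avoid : ∀ q r, C'.edge q r → q.last ≠ r.last → ∀ m ≤ l,
    ∀ a ∈ Metric.closedBall (C'.x q) C'.radius, ∀ b ∈ Metric.closedBall (C'.y r) C'.radius,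
      (a, b) ∉ gluedGraph g m

theorem eventually_disjoint_closedBall {X : Type*} [MetricSpace X] {a b : X} (h : a ≠ b) :
    ∀ᶠ ε in 𝓝 (0 : ℝ), Disjoint (Metric.closedBall a ε) (Metric.closedBall b ε) := by
  have h1 : 0 < dist a b / 2 := half_pos (dist_pos.2 h)
  filter_upwards [gt_mem_nhds h1] with ε hε
  exact Metric.closedBall_disjoint_closedBall (by linarith)

/-- Colouring a sequence by its last term and asking for new labels beyond `l` produces the points
and labels. The other requirements are finitely many conditions that hold for all small radii. -/
theorem Stage.exists_isNext [Nonempty (SeqProd A)] (hf : IsDepartureSituation A f)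
    (hO : IsGenericOrbit g G OZ OT) (hG : G ⊆ commonDomain g)
    (hdis : ∀ m p q, p ≠ q → Disjoint (g m p).source (g m q).source)
    {O : Set Z} (hOo : IsOpen O) (hGO : G ⊆ O) {l : ℕ} (C : Stage f g OZ OT l) :
    ∃ C' : Stage f g OZ OT (l + 1), C.IsNext O C' := by
  obtain ⟨E', hE', hRE', hEE'⟩ := exists_isTree_lift C.isTree.connected
    (FinSeqOfLength.init_surjective l) (hf.isAcyclic_bipGraph (l + 1))
    (fun q r h => C.edge_of_graphRel _ _ (hf.graphRel_init h))
  obtain ⟨x', y', w', hr', hx', hy', hxN, hyN, hdiag, hfresh⟩ := C.real.exists_lift hO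
    C.x_injective C.y_injective (fun q r => FinSeqOfLength.ext_init_last) hE' hEE' l
    (N := fun s => Metric.ball (C.x s) C.radius) (N' := fun t => Metric.ball (C.y t) C.radius)
    (fun s => ⟨Metric.isOpen_ball, Metric.mem_ball_self C.radius_pos⟩)
    (fun s => ⟨Metric.isOpen_ball, Metric.mem_ball_self C.radius_pos⟩)
  have h1 : ∀ᶠ ε in 𝓝 (0 : ℝ), ∀ q, Metric.closedBall (x' q) ε ⊆
      Metric.ball (C.x q.init) C.radius ∩ O := eventually_all.2 fun q =>
    eventually_closedBall_subset ((Metric.isOpen_ball.inter hOo).mem_nhds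
      ⟨hxN q, hGO (hO.subset (hr'.mem_left q))⟩)
  have h2 : ∀ᶠ ε in 𝓝 (0 : ℝ), ∀ q, Metric.closedBall (y' q) ε ⊆
      Metric.ball (C.y q.init) C.radius := eventually_all.2 fun q =>
    eventually_closedBall_subset (Metric.isOpen_ball.mem_nhds (hyN q))
  have h3 : ∀ᶠ ε in 𝓝 (0 : ℝ), ∀ q r, q ≠ r → Disjoint (Metric.closedBall (x' q) ε)
      (Metric.closedBall (x' r) ε) := eventually_all.2 fun q => eventually_all.2 fun r =>
    eventually_imp_distrib_left.2 fun h => eventually_disjoint_closedBall (hx'.ne h)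
  have h4 : ∀ᶠ ε in 𝓝 (0 : ℝ), ∀ q r, q ≠ r → Disjoint (Metric.closedBall (y' q) ε)
      (Metric.closedBall (y' r) ε) := eventually_all.2 fun q => eventually_all.2 fun r =>
    eventually_imp_distrib_left.2 fun h => eventually_disjoint_closedBall (hy'.ne h)
  have h5 : ∀ᶠ ε in 𝓝 (0 : ℝ), ∀ q r, E' q r → q.last ≠ r.last → ∀ m ∈ Iic l,
      ∀ a ∈ Metric.closedBall (x' q) ε, ∀ b ∈ Metric.closedBall (y' r) ε,
        (a, b) ∉ gluedGraph g m := by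
    refine eventually_all.2 fun q => eventually_all.2 fun r => eventually_imp_distrib_left.2
      fun hqr => eventually_imp_distrib_left.2 fun hc => (eventually_all_finite (finite_Iic l)).2
      fun m hm => ?_
    obtain ⟨p, hp⟩ := mem_iUnion.1 (mem_iInter.1 (hG (hO.subset (hr'.mem_left q))) m)
    -- The edge label has first coordinate larger than `l ≥ m`, so it is not `(m, p)`. The
    -- inequality persists for nearby pairs, where `g_m` is still given by `g_{m,p}` because the
    -- domains are disjoint.
    have hne : g m p (x' q) ≠ y' r := by
      rw [← hr'.apply_eq q r hqr]
      refine hO.apply_ne (hr'.mem_left q) (w := (m, p)) hp (hr'.mem_source q r hqr) fun h => ?_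
      have := hfresh q r hqr hc
      rw [← h] at this
      exact absurd this (not_lt.2 hm)
    have hopen : {ab : Z × T | ab.1 ∈ (g m p).source ∧ g m p ab.1 ≠ ab.2} ∈ 𝓝 (x' q, y' r) := by
      have hc1 : ContinuousAt (fun ab : Z × T => g m p ab.1) (x' q, y' r) :=
        ContinuousAt.comp (x := (x' q, y' r)) ((g m p).continuousAt hp) continuousAt_fst
      exact (continuousAt_fst.eventually ((g m p).open_source.mem_nhds hp)).and
        ((hc1.prodMk continuousAt_snd).eventually (isClosed_diagonal.isOpen_compl.mem_nhds hne))
    filter_upwards [eventually_closedBall_subset hopen] with ε hε a ha b hb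
    rw [← closedBall_prod_same] at hε
    obtain ⟨has, hab⟩ := hε (mk_mem_prod ha hb)
    rintro ⟨p', hp', he⟩
    by_cases hpp : p' = p
    · subst hpp
      exact hab he
    · exact (hdis m p' p hpp).notMem_of_mem_left hp' has
  have h6 : ∀ᶠ ε in 𝓝 (0 : ℝ), ε ≤ (1 / 2) ^ (l + 1) :=
    (gt_mem_nhds (by positivity)).mono fun ε h => le_of_lt h
  obtain ⟨ε, ⟨h1, h2, h3, h4, h5, h6⟩, hε⟩ :=
    (((h1.and (h2.and (h3.and (h4.and (h5.and h6))))).filter_mono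
      (nhdsWithin_le_nhds (s := Ioi 0))).and self_mem_nhdsWithin).exists
  exact ⟨⟨E', hE', hRE', x', y', w', hr', hx', hy', ε, hε, h6⟩, ⟨h1, h2, h3, h4, hdiag, h5⟩⟩

theorem exists_stage_zero (hO : IsGenericOrbit g G OZ OT) (hne : OZ.Nonempty)
    (hG : G ⊆ commonDomain g) : Nonempty (Stage f g OZ OT 0) := by
  obtain ⟨z, hz⟩ := hne
  obtain ⟨p, hp⟩ := mem_iUnion.1 (mem_iInter.1 (hG (hO.subset hz)) 0)
  have hsub : Subsingleton (FinSeqOfLength A 0) := ⟨fun s t => Subtype.ext (by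
    rw [List.eq_nil_of_length_eq_zero s.2.1, List.eq_nil_of_length_eq_zero t.2.1])⟩
  let s₀ : FinSeqOfLength A 0 := ⟨[], rfl, fun i h => absurd h (by simp)⟩
  have hpre : (bipGraph fun _ _ : FinSeqOfLength A 0 => True).Preconnected := by
    have h1 : ∀ s t : FinSeqOfLength A 0, (bipGraph fun _ _ : FinSeqOfLength A 0 => True).Reachable
        (Sum.inl s) (Sum.inr t) := fun s t =>
      SimpleGraph.Adj.reachable (by simp)
    rintro (s | s) (t | t)
    · rw [Subsingleton.elim s t]
    · exact h1 s t
    · exact (h1 t s).symm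
    · rw [Subsingleton.elim s t]
  have hcard : ENat.card (FinSeqOfLength A 0 ⊕ FinSeqOfLength A 0) ≤ 2 := by
    have h1 : ENat.card (FinSeqOfLength A 0) ≤ 1 := ENat.card_le_one_iff_subsingleton _ |>.2 hsub
    rw [ENat.card_sum]
    exact (add_le_add h1 h1).trans (by norm_num)
  exact ⟨{
    edge := fun _ _ => True
    isTree := { connected := { preconnected := hpre, nonempty := ⟨Sum.inl s₀⟩ }
                isAcyclic := SimpleGraph.IsAcyclic.of_card_le_two hcard }
    edge_of_graphRel := fun _ _ _ => trivial
    x := fun _ => z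
    y := fun _ => g 0 p z
    label := fun _ _ => (0, p)
    real := ⟨fun _ => hz, fun _ => hO.map z hz (0, p) hp, fun _ _ _ => hp, fun _ _ _ => rfl⟩
    x_injective := Function.injective_of_subsingleton _
    y_injective := Function.injective_of_subsingleton _
    radius := 1
    radius_pos := one_pos
    radius_le := by simp }⟩

theorem exists_stage_sequence [Nonempty (SeqProd A)] (hf : IsDepartureSituation A f)
    (hO : IsGenericOrbit g G OZ OT) (hne : OZ.Nonempty) (hG : G ⊆ commonDomain g)
    (hdis : ∀ m p q, p ≠ q → Disjoint (g m p).source (g m q).source)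
    {O : ℕ → Set Z} (hOo : ∀ l, IsOpen (O l)) (hGO : ∀ l, G ⊆ O l) :
    ∃ C : ∀ l, Stage f g OZ OT l, ∀ l, (C l).IsNext (O l) (C (l + 1)) := by
  obtain ⟨C₀⟩ := exists_stage_zero (f := f) hO hne hG
  choose next hnext using fun (l : ℕ) (C : Stage f g OZ OT l) =>
    C.exists_isNext hf hO hG hdis (hOo l) (hGO l)
  exact ⟨fun l => Nat.rec C₀ next l, fun l => hnext l _⟩

theorem exists_embedding_of_isGenericOrbit [CompleteSpace Z] [CompleteSpace T]
    (hf : IsDepartureSituation A f) (hO : IsGenericOrbit g G OZ OT) (hne : OZ.Nonempty)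
    (hG : IsResidualDomain g G)
    (hdis : ∀ m p q, p ≠ q → Disjoint (g m p).source (g m q).source)
    (hclopen : ∀ m p, IsClopen (g m p).source) :
    ∃ (u : SeqProd A → G) (v : SeqProd A → T),
      Continuous u ∧ Function.Injective u ∧ Continuous v ∧ Function.Injective v ∧
      (∀ x y : SeqProd A, (x, y) ∈ unionGraph f → v y ∈ valueSet g (u x : Z)) ∧
      (∀ x y : SeqProd A, x ∈ commonDomain f →
        (x, y) ∈ closure (unionGraph f) \ unionGraph f →
        v y ∈ closure (valueSet g (u x : Z)) \ valueSet g (u x : Z)) := by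
  have := hf.general.left_space.nonempty
  obtain ⟨O, hOo, hGO⟩ := hG.isGδ.eq_iInter_nat
  obtain ⟨C, hC⟩ := exists_stage_sequence hf hO hne hG.subset hdis hOo
    (fun l => hGO.trans_subset (iInter_subset O l))
  have hlim : Tendsto (fun l => (C l).radius) atTop (𝓝 0) :=
    squeeze_zero (fun l => (C l).radius_pos.le) (fun l => (C l).radius_le)
      (tendsto_pow_atTop_nhds_zero_of_lt_one (by norm_num) (by norm_num))
  obtain ⟨u, hu, hui, hub, hul⟩ := exists_continuous_injective_of_scheme (fun l => (C l).x)
    (fun l => (C l).radius) (fun l => (C l).radius_pos) hlim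
    (fun l q => ((hC l).ball_x q).trans (inter_subset_left.trans Metric.ball_subset_closedBall))
    (fun l => (hC l).disjoint_x)
  obtain ⟨v, hv, hvi, hvb, hvl⟩ := exists_continuous_injective_of_scheme (fun l => (C l).y)
    (fun l => (C l).radius) (fun l => (C l).radius_pos) hlim
    (fun l q => ((hC l).ball_y q).trans Metric.ball_subset_closedBall)
    (fun l => (hC l).disjoint_y)
  have huG : ∀ x, u x ∈ G := fun x => by
    rw [hGO]
    exact mem_iInter.2 fun l => ((hC l).ball_x _ (hub x (l + 1))).2
  have hval : ∀ x y : SeqProd A, (x, y) ∈ unionGraph f → v y ∈ valueSet g (u x) := by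
    intro x y hxy
    obtain ⟨n, hn⟩ := mem_iUnion.1 hxy
    have hedge : ∀ l, (C l).edge (x.restrict l) (y.restrict l) := fun l =>
      (C l).edge_of_graphRel _ _ ⟨n, hf.relAt_restrict hn l⟩
    obtain ⟨p, hp, he⟩ := hn
    obtain ⟨q₀, hq₀⟩ := hf.eventually_eq n p
    set w := (C (q₀ + 1)).label (x.restrict (q₀ + 1)) (y.restrict (q₀ + 1)) with hw
    -- The step from `l` to `l + 1` appends coordinate `l`, where `x` and `y` agree once `l > q₀`.
    have hlab : ∀ l ≥ q₀ + 1, (C l).label (x.restrict l) (y.restrict l) = w := by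
      intro l hl
      induction l, hl using Nat.le_induction with
      | base => rfl
      | succ l hl ih =>
        have hlast := hq₀ l (by omega) x hp
        rw [show f n p x = y from he] at hlast
        rw [(hC l).label_eq _ _ (hedge _) (by simp [hlast])]
        simpa using ih
    have hsrc : ∀ l ≥ q₀ + 1, (C l).x (x.restrict l) ∈ (g w.1 w.2).source := fun l hl => by
      rw [← hlab l hl]
      exact (C l).real.mem_source _ _ (hedge l)
    -- The domain is closed, so the limit stays where `g_w` is defined and continuous.
    have hus : u x ∈ (g w.1 w.2).source := (hclopen _ _).1.mem_of_tendsto (hul x)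
      ((eventually_ge_atTop (q₀ + 1)).mono hsrc)
    refine ⟨w.1, w.2, hus, ?_⟩
    refine tendsto_nhds_unique (((g w.1 w.2).continuousAt hus).tendsto.comp (hul x))
      ((hvl y).congr' ?_)
    filter_upwards [eventually_ge_atTop (q₀ + 1)] with l hl
    rw [← (C l).real.apply_eq _ _ (hedge l), hlab l hl]
    rfl
  refine ⟨fun x => ⟨u x, huG x⟩, v, hu.subtype_mk _, fun x y h => hui (congrArg Subtype.val h), hv,
    hvi, hval, fun x y hx hxy => ?_⟩
  obtain ⟨⟨yk, hyk, hxyk⟩, -⟩ := hf.closure_graph x y hx hxy.1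
  refine ⟨mem_closure_of_tendsto ((hv.tendsto y).comp hyk)
    (Eventually.of_forall fun k => hval x _ (hxyk k)), ?_⟩
  rintro ⟨m, hm⟩
  have hrel := hf.graphRel_of_tendsto hyk hxyk
  -- At such an `l` the restrictions to length `l + 1` have distinct last terms and are still
  -- related by `R`, so the balls around them avoid the graph of `g_m`.
  obtain ⟨l, hl, hne'⟩ : ∃ l ≥ m, x.1 l ≠ y.1 l := by
    by_contra! h
    exact hxy.2 (hf.mem_unionGraph_of_eventually_eq hx hrel h)
  exact (hC l).avoid _ _ ((C (l + 1)).edge_of_graphRel _ _ (hrel (l + 1))) (by simpa using hne') m hl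
    _ (hub x (l + 1)) _ (hvb y (l + 1)) hm

end Construction

theorem mainTheorem5
    (A : ℕ → Finset ℕ) (f : ℕ → ℕ → OpenPartialHomeomorph (SeqProd A) (SeqProd A))
    (hf : IsDepartureSituation A f)
    {Z : Type*} {T : Type*} [MetricSpace Z] [MetricSpace T]
    (g : ℕ → ℕ → OpenPartialHomeomorph Z T) (hg : IsArrivalSituation g)
    (G : Set Z) (hG : IsResidualDomain g G) :
    ∃ (u : SeqProd A → G) (v : SeqProd A → T),
      Continuous u ∧ Function.Injective u ∧ Continuous v ∧ Function.Injective v ∧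
      (∀ x y : SeqProd A, (x, y) ∈ unionGraph f → v y ∈ valueSet g (u x : Z)) ∧
      (∀ x y : SeqProd A, x ∈ commonDomain f →
        (x, y) ∈ closure (unionGraph f) \ unionGraph f →
        v y ∈ closure (valueSet g (u x : Z)) \ valueSet g (u x : Z)) := by
  have := hg.general.left_space.polish
  have := hg.general.right_space.polish
  have := hg.general.left_space.nonempty
  obtain ⟨OZ, OT, hO, hne⟩ := exists_isGenericOrbit hg.general.left_space.zeroDim
    hg.general.disjoint_sources hg.general.dense_domain hg.free hG
  -- The given metrics need not be complete; the scheme of balls uses complete compatible ones.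
  let mZ := TopologicalSpace.upgradeIsCompletelyMetrizable Z
  let mT := TopologicalSpace.upgradeIsCompletelyMetrizable T
  exact @exists_embedding_of_isGenericOrbit Z T A mZ.toMetricSpace mT.toMetricSpace f g G OZ OT
    mZ.toCompleteSpace mT.toCompleteSpace hf hO hne hG hg.general.disjoint_sources
    hg.general.clopen_source
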